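/- For a complex polynomial $f$ of degree $d\ge 2$ let $X(f)=\{z\in\mathbb{C}: f^n(z)\to\infty\}$ be its basin of infinity and $G_f(z)=\lim_{n\to\infty}d^{-n}\log^+|f^n(z)|$ its Green function. The DeMarco–McMullen tree $T(f)$ is the quotient space of $X(f)$ obtained by collapsing each connected component of a level set of $G_f|_{X(f)}$ to a point; $\pi_f:X(f)\to T(f)$ is the quotient map, $\sigma_f:T(f)\to T(f)$ is the map with $\sigma_f\circ\pi_f=\pi_f\circ f$, $h_f:T(f)\to\mathbb{R}$ is the height function with $G_f=h_f\circ\pi_f$, and $d_f$ is the path metric induced by $h_f$: $d_f(x,y)$ is the infimum, over all paths $\gamma:[0,1]\to T(f)$ from $x$ to $y$, of the total variation of $h_f\circ\gamma$. A homeomorphism $\phi:U\to V$ between open subsets of $\mathbb{C}$ is $K$-quasiconformal ($K\ge1$) if it is absolutely continuous on lines, differentiable almost everywhere in $U$, and $|\bar\partial\phi|\le\frac{K-1}{K+1}|\partial\phi|$ almost everywhere in $U$. Let $f,g$ be complex polynomials of degree at least $2$, and let $\phi$ be a conjugacy between $(f,X(f))$ and $(g,X(g))$, that is, a homeomorphism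 $\phi:X(f)\to X(g)$ with $\phi\circ f=g\circ\phi$ on $X(f)$. Then: 1. For all $z_1,z_2\in X(f)$: $G_f(z_1)>G_f(z_2)$ if and only if $G_g(\phi(z_1))>G_g(\phi(z_2))$. 2. If $\phi$ is $K$-quasiconformal, then for all $z_1,z_2\in X(f)$ with $G_f(z_1)\ge G_f(z_2)$, $$\frac{G_f(z_1)-G_f(z_2)}{K}\le G_g(\phi(z_1))-G_g(\phi(z_2))\le K\,\bigl(G_f(z_1)-G_f(z_2)\bigr).$$ 3. There is a homeomorphism $\iota_\phi:T(f)\to T(g)$, induced by $\phi$ in the sense that $\iota_\phi\circ\pi_f=\pi_g\circ\phi$, which commutes with the tree dynamics, $\iota_\phi\circ\sigma_f=\sigma_g\circ\iota_\phi$, and preserves the strict order of heights: $h_f(x)>h_f(y)$ if and only if $h_g(\iota_\phi(x))>h_g(\iota_\phi(y))$. If $\phi$ is $K$-quasiconformal, then for all $x,y\in T(f)$ $$\frac{d_f(x,y)}{K}\le d_g(\iota_\phi(x),\iota_\phi(y))\le K\,d_f(x,y).$$ -/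

import Mathlib

open Filter Topology MeasureTheory
open scoped ENNReal

namespace PolyBasin

noncomputable section

/-- The basin of infinity `X(f) = {z ∈ ℂ : fⁿ(z) → ∞}` of a complex polynomial. -/
def basin (f : Polynomial ℂ) : Set ℂ :=
  {z | Tendsto (fun n : ℕ => ‖(fun w => f.eval w)^[n] z‖) atTop atTop}

/-- The Green function `G_f(z) = lim d⁻ⁿ log⁺ |fⁿ(z)|`, where `d` is the degree of `f`.
The limit exists when `d ≥ 2`, see `tendsto_green`. -/
def green (f : Polynomial ℂ) (z : ℂ) : ℝ :=
  limUnder atTop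
    (fun n : ℕ => ((f.natDegree : ℝ) ^ n)⁻¹ * Real.posLog ‖(fun w => f.eval w)^[n] z‖)

theorem eval_mem_basin (f : Polynomial ℂ) {z : ℂ} (hz : z ∈ basin f) :
    f.eval z ∈ basin f := by
  have h := (tendsto_add_atTop_iff_nat 1).2 hz
  simpa [basin, Function.iterate_succ_apply] using h

/-- The restriction `f : X(f) → X(f)`. -/
def basinMap (f : Polynomial ℂ) (z : basin f) : basin f :=
  ⟨f.eval (z : ℂ), eval_mem_basin f z.2⟩

/-! ### Existence of the Green function and its functional equation -/

theorem exists_upper (f : Polynomial ℂ) :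
    ∃ C : ℝ, ∀ w : ℂ, Real.posLog ‖f.eval w‖ ≤ f.natDegree * Real.posLog ‖w‖ + C := by
  set S : ℝ := ∑ i ∈ Finset.range (f.natDegree + 1), ‖f.coeff i‖ with hS
  have hS0 : 0 ≤ S := Finset.sum_nonneg fun _ _ => norm_nonneg _
  refine ⟨Real.posLog S, fun w => ?_⟩
  have hm : (1 : ℝ) ≤ max 1 ‖w‖ := le_max_left _ _
  have h1 : ‖f.eval w‖ ≤ (max 1 ‖w‖) ^ f.natDegree * S := by
    rw [Polynomial.eval_eq_sum_range, hS, Finset.mul_sum]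
    refine (norm_sum_le _ _).trans (Finset.sum_le_sum fun i hi => ?_)
    rw [norm_mul, norm_pow, mul_comm]
    refine mul_le_mul_of_nonneg_right ?_ (norm_nonneg _)
    calc ‖w‖ ^ i ≤ (max 1 ‖w‖) ^ i := by gcongr; exact le_max_right _ _
      _ ≤ _ := pow_le_pow_right₀ hm (by simpa [Nat.lt_succ_iff] using hi)
  calc Real.posLog ‖f.eval w‖ ≤ Real.posLog ((max 1 ‖w‖) ^ f.natDegree * S) :=
        Real.posLog_le_posLog (norm_nonneg _) h1
    _ ≤ Real.posLog ((max 1 ‖w‖) ^ f.natDegree) + Real.posLog S := Real.posLog_mul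
    _ = _ := by
        rw [Real.posLog_pow, Real.posLog_eq_log (x := max 1 ‖w‖) (by rwa [abs_of_nonneg (by linarith)]),
          ← Real.posLog_eq_log_max_one (norm_nonneg _)]

theorem exists_lower (f : Polynomial ℂ) (hf : f ≠ 0) :
    ∃ C : ℝ, 0 ≤ C ∧ ∀ w : ℂ, f.natDegree * Real.posLog ‖w‖ ≤ Real.posLog ‖f.eval w‖ + C := by
  have hlead : f.reverse.eval 0 ≠ 0 := by
    rw [← Polynomial.coeff_zero_eq_eval_zero, Polynomial.coeff_zero_reverse]
    simpa using hf
  set c : ℝ := ‖f.reverse.eval 0‖ / 2 with hc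
  have hc0 : 0 < c := by have := norm_pos_iff.2 hlead; positivity
  have hcont : ∀ᶠ v in 𝓝 (0 : ℂ), c < ‖f.reverse.eval v‖ := by
    have : ContinuousAt (fun v : ℂ => ‖f.reverse.eval v‖) 0 :=
      (f.reverse.continuous.norm).continuousAt
    refine this.eventually (lt_mem_nhds ?_)
    have := norm_pos_iff.2 hlead
    simp only [hc]; linarith
  obtain ⟨r, hr, hball⟩ := Metric.eventually_nhds_iff.1 hcont
  refine ⟨f.natDegree * Real.posLog r⁻¹ + Real.posLog c⁻¹,
    add_nonneg (mul_nonneg (Nat.cast_nonneg _) Real.posLog_nonneg) Real.posLog_nonneg,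
    fun w => ?_⟩
  have hp := Real.posLog_nonneg (x := ‖f.eval w‖)
  have hq := Real.posLog_nonneg (x := c⁻¹)
  have hR := mul_nonneg (Nat.cast_nonneg (α := ℝ) f.natDegree) (Real.posLog_nonneg (x := r⁻¹))
  rcases le_or_gt ‖w‖ r⁻¹ with hw | hw
  · have := mul_le_mul_of_nonneg_left (Real.posLog_le_posLog (norm_nonneg w) hw)
      (Nat.cast_nonneg (α := ℝ) f.natDegree)
    linarith
  · have hw0 : 0 < ‖w‖ := (inv_pos.2 hr).trans hw
    have hne : w ≠ 0 := norm_pos_iff.1 hw0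
    have hv : c < ‖f.reverse.eval w⁻¹‖ := by
      apply hball
      rw [dist_zero_right, norm_inv]
      exact inv_lt_of_inv_lt₀ hr hw
    have hrev : f.reverse.eval w⁻¹ * w ^ f.natDegree = f.eval w := by
      have : Invertible w := invertibleOfNonzero hne
      have := Polynomial.eval₂_reverse_mul_pow (RingHom.id ℂ) w f
      simpa [Polynomial.eval₂_id, invOf_eq_inv] using this
    have h2 : ‖w‖ ^ f.natDegree ≤ ‖f.eval w‖ * c⁻¹ := by
      rw [← div_eq_mul_inv, le_div_iff₀ hc0, ← hrev, norm_mul, norm_pow, mul_comm]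
      exact mul_le_mul_of_nonneg_right hv.le (by positivity)
    have h3 := (Real.posLog_le_posLog (by positivity) h2).trans Real.posLog_mul
    rw [Real.posLog_pow] at h3
    linarith

/-- The limit defining the Green function exists. -/
theorem tendsto_green (f : Polynomial ℂ) (hf : 2 ≤ f.natDegree) (z : ℂ) :
    Tendsto
      (fun n : ℕ => ((f.natDegree : ℝ) ^ n)⁻¹ * Real.posLog ‖(fun w => f.eval w)^[n] z‖)
      atTop (𝓝 (green f z)) := by
  have hf0 : f ≠ 0 := by rintro rfl; simp at hf
  obtain ⟨C₁, h₁⟩ := exists_upper f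
  obtain ⟨C₂, -, h₂⟩ := exists_lower f hf0
  have hd : (2 : ℝ) ≤ f.natDegree := by exact_mod_cast hf
  have hd0 : (0 : ℝ) < f.natDegree := by linarith
  refine tendsto_nhds_limUnder (cauchySeq_tendsto_of_complete (cauchySeq_of_le_geometric
    ((f.natDegree : ℝ)⁻¹) (max C₁ C₂ * (f.natDegree : ℝ)⁻¹)
    (inv_lt_one_of_one_lt₀ (by linarith)) fun n => ?_))
  rw [Function.iterate_succ_apply']
  set w := (fun w => f.eval w)^[n] z
  have key : |f.natDegree * Real.posLog ‖w‖ - Real.posLog ‖f.eval w‖| ≤ max C₁ C₂ := by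
    rw [abs_le]
    have a := h₁ w
    have b := h₂ w
    have := le_max_left C₁ C₂
    have := le_max_right C₁ C₂
    constructor <;> linarith
  have e : ((f.natDegree : ℝ) ^ n)⁻¹ * Real.posLog ‖w‖
        - ((f.natDegree : ℝ) ^ (n + 1))⁻¹ * Real.posLog ‖f.eval w‖
      = ((f.natDegree : ℝ) ^ (n + 1))⁻¹ *
        (f.natDegree * Real.posLog ‖w‖ - Real.posLog ‖f.eval w‖) := by
    have hi : ((f.natDegree : ℝ) ^ (n + 1))⁻¹ * f.natDegree = ((f.natDegree : ℝ) ^ n)⁻¹ := by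
      rw [pow_succ, mul_inv, mul_assoc, inv_mul_cancel₀ hd0.ne', mul_one]
    rw [mul_sub, ← mul_assoc, hi]
  rw [Real.dist_eq, e, abs_mul, abs_of_pos (by positivity)]
  calc _ ≤ ((f.natDegree : ℝ) ^ (n + 1))⁻¹ * max C₁ C₂ := by gcongr
    _ = _ := by rw [pow_succ, mul_inv, inv_pow]; ring

/-- `G_f ∘ f = d · G_f`. -/
theorem green_eval (f : Polynomial ℂ) (hf : 2 ≤ f.natDegree) (z : ℂ) :
    green f (f.eval z) = f.natDegree * green f z := by
  have hd0 : (f.natDegree : ℝ) ≠ 0 := by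
    have : f.natDegree ≠ 0 := by omega
    exact_mod_cast this
  have h₁ := tendsto_green f hf (f.eval z)
  have h₂ := ((tendsto_add_atTop_iff_nat 1).2 (tendsto_green f hf z)).const_mul
    (f.natDegree : ℝ)
  refine tendsto_nhds_unique h₁ (h₂.congr fun n => ?_)
  rw [Function.iterate_succ_apply, pow_succ, mul_inv]
  field_simp

/-! ### The DeMarco–McMullen tree -/

/-- The level set of `G_f` in `X(f)` through `z`. -/
def levelSet (f : Polynomial ℂ) (z : basin f) : Set (basin f) :=
  {w | green f w = green f z}

theorem mem_levelSet {f : Polynomial ℂ} {z w : basin f} :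
    w ∈ levelSet f z ↔ green f w = green f z := Iff.rfl

theorem levelSet_eq {f : Polynomial ℂ} {z w : basin f} (h : w ∈ levelSet f z) :
    levelSet f w = levelSet f z := by
  ext x
  rw [mem_levelSet] at h
  rw [mem_levelSet, mem_levelSet, h]

theorem self_mem_levelSet (f : Polynomial ℂ) (z : basin f) : z ∈ levelSet f z := rfl

/-- Two points of `X(f)` are equivalent when they lie in the same connected component of
a level set of `G_f`. -/
def treeSetoid (f : Polynomial ℂ) : Setoid (basin f) where
  r z w := w ∈ connectedComponentIn (levelSet f z) z
  iseqv := by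
    have symm : ∀ {z w : basin f}, w ∈ connectedComponentIn (levelSet f z) z →
        z ∈ connectedComponentIn (levelSet f w) w := by
      intro z w h
      rw [levelSet_eq (connectedComponentIn_subset _ _ h), ← connectedComponentIn_eq h]
      exact mem_connectedComponentIn (self_mem_levelSet f z)
    refine ⟨fun z => mem_connectedComponentIn (self_mem_levelSet f z), symm, ?_⟩
    intro x y z hxy hyz
    rw [levelSet_eq (connectedComponentIn_subset _ _ hxy), ← connectedComponentIn_eq hxy] at hyz
    exact hyz

/-- The DeMarco–McMullen tree `T(f)`: the quotient of `X(f)` obtained by collapsing each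
connected component of a level set of `G_f` to a point, with the quotient topology. -/
def Tree (f : Polynomial ℂ) : Type := Quotient (treeSetoid f)

instance (f : Polynomial ℂ) : TopologicalSpace (Tree f) :=
  inferInstanceAs (TopologicalSpace (Quotient (treeSetoid f)))

/-- The quotient map `π_f : X(f) → T(f)`. -/
def treeProj (f : Polynomial ℂ) (z : basin f) : Tree f := Quotient.mk (treeSetoid f) z

theorem continuous_basinMap (f : Polynomial ℂ) : Continuous (basinMap f) :=
  (f.continuous.comp continuous_subtype_val).subtype_mk _

theorem treeSetoid_basinMap (f : Polynomial ℂ) (hf : 2 ≤ f.natDegree) (z w : basin f)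
    (h : treeSetoid f z w) : treeSetoid f (basinMap f z) (basinMap f w) := by
  have hpre : IsPreconnected (basinMap f '' connectedComponentIn (levelSet f z) z) :=
    isPreconnected_connectedComponentIn.image _ (continuous_basinMap f).continuousOn
  refine hpre.subset_connectedComponentIn
    ⟨z, mem_connectedComponentIn (self_mem_levelSet f z), rfl⟩ ?_ ⟨w, h, rfl⟩
  rintro _ ⟨x, hx, rfl⟩
  have hx' := mem_levelSet.1 (connectedComponentIn_subset _ _ hx)
  rw [mem_levelSet, basinMap, basinMap, green_eval f hf, green_eval f hf, hx']

/-- The tree map `σ_f : T(f) → T(f)`, determined by `σ_f ∘ π_f = π_f ∘ f`. -/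
def treeMap (f : Polynomial ℂ) (hf : 2 ≤ f.natDegree) : Tree f → Tree f :=
  Quotient.map (basinMap f) (treeSetoid_basinMap f hf)

/-- The height function `h_f : T(f) → ℝ`, determined by `G_f = h_f ∘ π_f`. -/
def treeHeight (f : Polynomial ℂ) : Tree f → ℝ :=
  Quotient.lift (fun z : basin f => green f z)
    fun z _ h => (mem_levelSet.1 (connectedComponentIn_subset (levelSet f z) z h)).symm

/-- The metric `d_f` on `T(f)` induced by the height function: the path metric, i.e. the
infimum over all paths `γ` in `T(f)` from `x` to `y` of the length of `γ` measured by the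
height, which is the total variation of `h_f ∘ γ`.  It is valued in `[0, ∞]`, so that no
value is assigned by convention. -/
def treeDist (f : Polynomial ℂ) (x y : Tree f) : ℝ≥0∞ :=
  ⨅ γ : Path x y, eVariationOn (fun t : unitInterval => treeHeight f (γ t)) Set.univ

/-! ### Conjugacies and quasiconformal maps -/

/-- `φ` conjugates `f : X(f) → X(f)` to `g : X(g) → X(g)`. -/
def IsConjugacy (f g : Polynomial ℂ) (φ : basin f ≃ₜ basin g) : Prop :=
  ∀ z : basin f, φ (basinMap f z) = basinMap g (φ z)

/-- A map between subsets of `ℂ`, extended by `0` to a map `ℂ → ℂ`. -/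
def extendZero {U V : Set ℂ} (φ : U → V) : ℂ → ℂ :=
  Function.extend Subtype.val (fun z => (φ z : ℂ)) (fun _ => 0)

/-- `∂F = (F_x - i F_y) / 2`. -/
def wirtinger (F : ℂ → ℂ) (z : ℂ) : ℂ :=
  (fderiv ℝ F z 1 - Complex.I * fderiv ℝ F z Complex.I) / 2

/-- `∂̄F = (F_x + i F_y) / 2`. -/
def wirtingerBar (F : ℂ → ℂ) (z : ℂ) : ℂ :=
  (fderiv ℝ F z 1 + Complex.I * fderiv ℝ F z Complex.I) / 2

/-- `F` is absolutely continuous on lines in `U`: for every closed rectangle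
`[a, b] × [c, d] ⊆ U`, `F` is absolutely continuous on almost every horizontal and on almost
every vertical segment of the rectangle. -/
def IsACL (F : ℂ → ℂ) (U : Set ℂ) : Prop :=
  ∀ a b c d : ℝ, a ≤ b → c ≤ d → Set.Icc a b ×ℂ Set.Icc c d ⊆ U →
    (∀ᵐ y : ℝ ∂(volume.restrict (Set.Icc c d)),
      AbsolutelyContinuousOnInterval (fun x : ℝ => F (⟨x, y⟩ : ℂ)) a b) ∧
    (∀ᵐ x : ℝ ∂(volume.restrict (Set.Icc a b)),
      AbsolutelyContinuousOnInterval (fun y : ℝ => F (⟨x, y⟩ : ℂ)) c d)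

/-- The analytic definition of a `K`-quasiconformal homeomorphism `φ : U → V` between open
subsets of the plane, `K ≥ 1`: `φ` is absolutely continuous on lines, differentiable almost
everywhere, and its Beltrami coefficient satisfies `|∂̄φ / ∂φ| ≤ k = (K - 1) / (K + 1)` almost
everywhere, i.e. `|∂̄φ| ≤ k |∂φ|`.  (In particular `φ` preserves the orientation.) -/
def IsQuasiconformal {U V : Set ℂ} (φ : U ≃ₜ V) (K : ℝ) : Prop :=
  1 ≤ K ∧ IsACL (extendZero φ) U ∧
  (∀ᵐ z : ℂ ∂(volume.restrict U), DifferentiableAt ℝ (extendZero φ) z) ∧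
  (∀ᵐ z : ℂ ∂(volume.restrict U),
    ‖wirtingerBar (extendZero φ) z‖ ≤ (K - 1) / (K + 1) * ‖wirtinger (extendZero φ) z‖)

end

end PolyBasin

namespace PolyBasin

/-! Everything is decided near infinity, because one iteration multiplies the potential by the
degree d. There the Böttcher coordinate b conjugates f to w ↦ w^d, and G_f = -log|b|. Writing b =
exp(-s) parametrises {G_f > M} by the half-plane Re s > M, on which G_f is Re s and f acts as s ↦ d
s (`BottcherChart`).

Two points of a level curve whose angles differ by 2πj/d^n have the same n-th iterate. So do their
images under a semiconjugacy, and these therefore have equal potential. Such angles are dense, so by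
continuity level sets go to level sets (`IsSemiconj.green_vertical`). Applied to φ and to its
inverse, this makes the potential of φ(z) an injective continuous function of the potential of z,
hence a monotone one; it increases because the dynamics raises potentials on both sides.

The same density argument shows more: on a level curve near infinity φ is, in Böttcher coordinates,
a character of ℝ with kernel 2πℤ, so a rotation or a reflection
(`IsSemiconj.exists_param_vertical`). In particular the degrees agree. Where φ is differentiable its
differential is thus isometric along the level curve, and the Beltrami inequality forces the factor
by which it multiplies dG into [1/K, K] (`IsConjugacy.exists_fderiv_green_eq`). Integrating along
one horizontal line on which φ is absolutely continuous gives the estimate near infinity; iteration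
carries it to the whole basin, since both sides scale by the same power of d.

A conjugacy carries components of level sets to components, so it descends to the trees. The path
metric only sees heights along paths, so the estimate on potentials passes to total variations and
then to infima. -/

/-! ### Growth, continuity and positivity of the Green function -/

theorem two_le_cast_natDegree {f : Polynomial ℂ} (hf : 2 ≤ f.natDegree) :
    (2 : ℝ) ≤ f.natDegree := by exact_mod_cast hf

theorem posLog_le_self {x : ℝ} (hx : 0 ≤ x) : Real.posLog x ≤ x := by
  rw [Real.posLog]
  refine max_le hx ?_
  rcases hx.eq_or_lt with rfl | h
  · simp
  · linarith [Real.log_le_sub_one_of_pos h]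

/-- The Green function is at bounded distance from `log⁺ |z|`. -/
theorem exists_abs_green_sub_posLog_le (f : Polynomial ℂ) (hf : 2 ≤ f.natDegree) :
    ∃ C : ℝ, ∀ z : ℂ, |green f z - Real.posLog ‖z‖| ≤ C := by
  have hf0 : f ≠ 0 := by rintro rfl; simp at hf
  obtain ⟨C₁, h₁⟩ := exists_upper f
  obtain ⟨C₂, -, h₂⟩ := exists_lower f hf0
  have hd := two_le_cast_natDegree hf
  set C := max C₁ C₂ with hC
  have key : ∀ w : ℂ, |Real.posLog ‖f.eval w‖ - f.natDegree * Real.posLog ‖w‖| ≤ C := by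
    intro w
    rw [abs_le]
    have a := h₁ w
    have b := h₂ w
    have := le_max_left C₁ C₂
    have := le_max_right C₁ C₂
    constructor <;> linarith
  have hC0 : 0 ≤ C := (abs_nonneg _).trans (key 0)
  have hn : ∀ n : ℕ, ∀ z : ℂ,
      |((f.natDegree : ℝ) ^ n)⁻¹ * Real.posLog ‖(fun w => f.eval w)^[n] z‖
        - Real.posLog ‖z‖| ≤ C := by
    intro n
    induction n with
    | zero => intro z; simpa using hC0
    | succ n ih =>
      intro z
      have a := ih (f.eval z)
      have b := key z
      rw [Function.iterate_succ_apply]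
      set q := Real.posLog ‖(fun w => f.eval w)^[n] (f.eval z)‖
      -- The same constant survives the induction: the two errors add up to at most 2C, and dividing
      -- by d ≥ 2 brings this back to C.
      have e : ((f.natDegree : ℝ) ^ (n + 1))⁻¹ * q - Real.posLog ‖z‖ =
          (f.natDegree : ℝ)⁻¹ * ((((f.natDegree : ℝ) ^ n)⁻¹ * q - Real.posLog ‖f.eval z‖) +
            (Real.posLog ‖f.eval z‖ - f.natDegree * Real.posLog ‖z‖)) := by
        field_simp
        ring
      rw [e, abs_mul, abs_of_pos (by positivity), inv_mul_le_iff₀ (by linarith)]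
      calc _ ≤ C + C := (abs_add_le _ _).trans (add_le_add a b)
        _ ≤ _ := by nlinarith
  refine ⟨C, fun z => ?_⟩
  exact le_of_tendsto ((tendsto_green f hf z).sub_const _).abs (Eventually.of_forall fun n => hn n z)

theorem green_iterate (f : Polynomial ℂ) (hf : 2 ≤ f.natDegree) (n : ℕ) (z : ℂ) :
    green f ((fun w => f.eval w)^[n] z) = (f.natDegree : ℝ) ^ n * green f z := by
  induction n with
  | zero => simp
  | succ n ih => rw [Function.iterate_succ_apply', green_eval f hf, ih]; ring

/-- The Green function is a uniform limit of continuous functions: the bounded error between G_f and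
log⁺ at the n-th iterate is divided by d^n. -/
theorem continuous_green (f : Polynomial ℂ) (hf : 2 ≤ f.natDegree) : Continuous (green f) := by
  obtain ⟨C, hC⟩ := exists_abs_green_sub_posLog_le f hf
  have hd := two_le_cast_natDegree hf
  have hiter : ∀ n : ℕ, Continuous (fun z : ℂ => (fun w => f.eval w)^[n] z) := fun n =>
    f.continuous.iterate n
  have hlim : Tendsto (fun n : ℕ => ((f.natDegree : ℝ)⁻¹) ^ n * C) atTop (𝓝 0) := by
    simpa using (tendsto_pow_atTop_nhds_zero_of_lt_one (by positivity)
      (inv_lt_one_of_one_lt₀ (by linarith))).mul_const C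
  have hu : TendstoUniformly
      (fun (n : ℕ) z => ((f.natDegree : ℝ) ^ n)⁻¹ * Real.posLog ‖(fun w => f.eval w)^[n] z‖)
      (green f) atTop := by
    rw [Metric.tendstoUniformly_iff]
    intro ε hε
    filter_upwards [hlim.eventually (gt_mem_nhds hε)] with n hn z
    refine lt_of_le_of_lt ?_ hn
    have := hC ((fun w => f.eval w)^[n] z)
    rw [green_iterate f hf] at this
    rw [Real.dist_eq]
    set q := Real.posLog ‖(fun w => f.eval w)^[n] z‖
    have e : green f z - ((f.natDegree : ℝ) ^ n)⁻¹ * q =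
        ((f.natDegree : ℝ)⁻¹) ^ n * ((f.natDegree : ℝ) ^ n * green f z - q) := by
      have : (f.natDegree : ℝ) ≠ 0 := by linarith
      rw [inv_pow]
      field_simp
    rw [e, abs_mul, abs_of_pos (by positivity)]
    gcongr
  refine hu.continuous (Frequently.of_forall fun n => ?_)
  exact continuous_const.mul (Real.continuous_posLog.comp (hiter n).norm)

/-- Since G_f(fⁿ(z)) = d^n G_f(z) stays within C of log⁺|fⁿ(z)|, the orbit escapes exactly when
G_f(z) is positive. -/
theorem mem_basin_iff (f : Polynomial ℂ) (hf : 2 ≤ f.natDegree) (z : ℂ) :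
    z ∈ basin f ↔ 0 < green f z := by
  obtain ⟨C, hC⟩ := exists_abs_green_sub_posLog_le f hf
  have hd := two_le_cast_natDegree hf
  constructor
  · intro h
    obtain ⟨n, hn⟩ := ((tendsto_atTop.1 h) (Real.exp (C + 1))).exists
    have h1 : C + 1 ≤ Real.posLog ‖(fun w => f.eval w)^[n] z‖ := by
      refine le_trans ?_ (le_max_right 0 (Real.log _))
      rwa [Real.le_log_iff_exp_le ((Real.exp_pos _).trans_le hn)]
    have h2 := (abs_le.1 (hC ((fun w => f.eval w)^[n] z))).1
    rw [green_iterate f hf] at h2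
    have h3 : 0 < (f.natDegree : ℝ) ^ n * green f z := by linarith
    exact pos_of_mul_pos_right h3 (by positivity)
  · intro h
    have h1 : Tendsto (fun n : ℕ => (f.natDegree : ℝ) ^ n * green f z - C) atTop atTop :=
      tendsto_atTop_add_const_right _ _
        ((tendsto_pow_atTop_atTop_of_one_lt (by linarith)).atTop_mul_const h)
    refine tendsto_atTop_mono (fun n => ?_) h1
    have h2 := (abs_le.1 (hC ((fun w => f.eval w)^[n] z))).2
    rw [green_iterate f hf] at h2
    linarith [posLog_le_self (norm_nonneg ((fun w => f.eval w)^[n] z))]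

theorem green_pos {f : Polynomial ℂ} (hf : 2 ≤ f.natDegree) (z : basin f) : 0 < green f z :=
  (mem_basin_iff f hf z).1 z.2

theorem isOpen_basin (f : Polynomial ℂ) (hf : 2 ≤ f.natDegree) : IsOpen (basin f) := by
  have : basin f = green f ⁻¹' Set.Ioi 0 := by
    ext z; exact mem_basin_iff f hf z
  rw [this]
  exact isOpen_Ioi.preimage (continuous_green f hf)

/-- Points of large potential are large. -/
theorem exists_norm_gt_of_green_gt (f : Polynomial ℂ) (hf : 2 ≤ f.natDegree) (R : ℝ) :
    ∃ M : ℝ, 0 < M ∧ ∀ z, M < green f z → R < ‖z‖ := by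
  obtain ⟨C, hC⟩ := exists_abs_green_sub_posLog_le f hf
  have hC0 : 0 ≤ C := (abs_nonneg _).trans (hC 0)
  refine ⟨C + |R| + 1, by positivity, fun z hz => ?_⟩
  have := (abs_le.1 (hC z)).2
  linarith [posLog_le_self (norm_nonneg z), le_abs_self R]

/-! ### Böttcher coordinates at infinity -/

theorem eval_reverse_inv_mul_pow (f : Polynomial ℂ) {z : ℂ} (hz : z ≠ 0) :
    f.reverse.eval z⁻¹ * z ^ f.natDegree = f.eval z := by
  have : Invertible z := invertibleOfNonzero hz
  have := Polynomial.eval₂_reverse_mul_pow (RingHom.id ℂ) z f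
  simpa [Polynomial.eval₂_id, invOf_eq_inv] using this

/-- A logarithm of the normalised Böttcher coordinate, in the coordinate `w = 1 / z`. -/
theorem exists_bottcher_log (f : Polynomial ℂ) (hf : 2 ≤ f.natDegree) :
    ∃ r : ℝ, 0 < r ∧ r ≤ 1 ∧ ∃ (T : ℂ → ℂ) (C : ℝ), DifferentiableOn ℂ T (Metric.ball 0 r) ∧
      ∀ w ∈ Metric.ball (0 : ℂ) r, ‖T w‖ ≤ C ∧ f.reverse.eval w ≠ 0 ∧
        ‖w ^ f.natDegree / f.reverse.eval w‖ ≤ ‖w‖ / 2 ∧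
        Complex.exp (T (w ^ f.natDegree / f.reverse.eval w)) * f.leadingCoeff =
          Complex.exp (T w) ^ f.natDegree * f.reverse.eval w := by
  have hf0 : f ≠ 0 := by rintro rfl; simp at hf
  set c := f.leadingCoeff with hc
  have hc0 : c ≠ 0 := by simpa [hc] using hf0
  set d := f.natDegree with hd
  have hd2 : (2 : ℝ) ≤ d := by exact_mod_cast hf
  have hdC : (d : ℂ) ≠ 0 := by
    have : d ≠ 0 := by omega
    exact_mod_cast this
  set R : ℂ → ℂ := fun w => f.reverse.eval w with hR
  have hRc : Continuous R := f.reverse.continuous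
  have hR0 : R 0 = c := by
    simp only [hR]
    rw [← Polynomial.coeff_zero_eq_eval_zero, Polynomial.coeff_zero_reverse]
  set u : ℂ → ℂ := fun w => c / R w with hu
  have hu0 : u 0 = 1 := by simp [hu, hR0, hc0]
  have huc : ContinuousAt u 0 := continuousAt_const.div hRc.continuousAt (by rwa [hR0])
  have e1 : ∀ᶠ w in 𝓝 (0 : ℂ), R w ≠ 0 := hRc.continuousAt.eventually_ne (by rwa [hR0])
  have e2 : ∀ᶠ w in 𝓝 (0 : ℂ), u w ∈ Complex.slitPlane :=
    huc.eventually_mem (by rw [hu0]; exact Complex.isOpen_slitPlane.mem_nhds (by simp))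
  have e3 : ∀ᶠ w in 𝓝 (0 : ℂ), ‖Complex.log (u w)‖ < 1 := by
    have : ContinuousAt (fun w => ‖Complex.log (u w)‖) 0 := (huc.clog (by simp [hu0])).norm
    exact this.eventually_lt continuousAt_const (by simp [hu0])
  have e4 : ∀ᶠ w in 𝓝 (0 : ℂ), ‖w‖ < ‖R w‖ / 2 := by
    refine ContinuousAt.eventually_lt (by fun_prop) (by fun_prop) ?_
    rw [hR0, norm_zero]
    have := norm_pos_iff.2 hc0
    linarith
  obtain ⟨r₀, hr₀, hball⟩ := Metric.eventually_nhds_iff_ball.1 (e1.and (e2.and (e3.and e4)))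
  set r := min r₀ 1 with hr
  have hrpos : 0 < r := lt_min hr₀ one_pos
  have hsub : Metric.ball (0 : ℂ) r ⊆ Metric.ball 0 r₀ := Metric.ball_subset_ball (min_le_left _ _)
  -- This is f in the coordinate w = 1/z: 1/f(1/w) = w^d / R(w), with a superattracting fixed point
  -- at 0.
  set F : ℂ → ℂ := fun w => w ^ d / R w with hF
  have hFle : ∀ w ∈ Metric.ball (0 : ℂ) r, ‖F w‖ ≤ ‖w‖ / 2 := by
    intro w hw
    obtain ⟨h1, -, -, h4⟩ := hball w (hsub hw)
    have hw1 : ‖w‖ ≤ 1 := (mem_ball_zero_iff.1 hw).le.trans (min_le_right _ _)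
    have hRpos := norm_pos_iff.2 h1
    simp only [hF]
    rw [norm_div, norm_pow, div_le_iff₀ hRpos]
    calc ‖w‖ ^ d ≤ ‖w‖ ^ 2 := pow_le_pow_of_le_one (norm_nonneg _) hw1 hf
      _ = ‖w‖ * ‖w‖ := sq _
      _ ≤ ‖w‖ * (‖R w‖ / 2) := by gcongr
      _ = _ := by ring
  have hFmaps : ∀ w ∈ Metric.ball (0 : ℂ) r, F w ∈ Metric.ball (0 : ℂ) r := by
    intro w hw
    have := hFle w hw
    rw [mem_ball_zero_iff] at hw ⊢
    linarith [norm_nonneg w]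
  have hRd : Differentiable ℂ R := f.reverse.differentiable
  have hFd : DifferentiableOn ℂ F (Metric.ball 0 r) := fun w hw =>
    ((differentiableAt_id.pow d).div hRd.differentiableAt
      (hball w (hsub hw)).1).differentiableWithinAt
  have hiter : ∀ n : ℕ, DifferentiableOn ℂ F^[n] (Metric.ball 0 r) ∧
      Set.MapsTo F^[n] (Metric.ball 0 r) (Metric.ball 0 r) := by
    intro n
    induction n with
    | zero => exact ⟨differentiableOn_id, Set.mapsTo_id _⟩
    | succ n ih =>
      rw [Function.iterate_succ']
      exact ⟨hFd.comp ih.1 ih.2, Set.MapsTo.comp hFmaps ih.2⟩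
  have hlog : DifferentiableOn ℂ (fun w => Complex.log (u w)) (Metric.ball 0 r) := fun w hw =>
    (((differentiableAt_const c).div hRd.differentiableAt (hball w (hsub hw)).1).clog
      (hball w (hsub hw)).2.1).differentiableWithinAt
  -- The sum T of this series solves d T(w) = log(c/R(w)) + T(F(w)), which is the logarithm of the
  -- Böttcher equation. The bound |log u| < 1 on the ball makes it converge uniformly.
  set t : ℕ → ℂ → ℂ := fun n w => ((d : ℂ) ^ (n + 1))⁻¹ * Complex.log (u (F^[n] w)) with ht
  set v : ℕ → ℝ := fun n => ((d : ℝ) ^ (n + 1))⁻¹ with hv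
  have hvs : Summable v := by
    have : Summable fun n : ℕ => ((d : ℝ)⁻¹) ^ n :=
      summable_geometric_of_lt_one (by positivity) (inv_lt_one_of_one_lt₀ (by linarith))
    simpa [hv, inv_pow] using (summable_nat_add_iff 1).2 this
  have htv : ∀ n, ∀ w ∈ Metric.ball (0 : ℂ) r, ‖t n w‖ ≤ v n := by
    intro n w hw
    have h3 := (hball _ (hsub ((hiter n).2 hw))).2.2.1
    simp only [ht, hv, norm_mul, norm_inv, norm_pow, Complex.norm_natCast]
    exact mul_le_of_le_one_right (by positivity) h3.le
  set T : ℂ → ℂ := fun w => ∑' n, t n w with hT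
  refine ⟨r, hrpos, min_le_right _ _, T, ∑' n, v n, ?_, fun w hw =>
    ⟨?_, (hball w (hsub hw)).1, hFle w hw, ?_⟩⟩
  · exact Complex.differentiableOn_tsum_of_summable_norm hvs
      (fun n => (differentiableOn_const _).mul (hlog.comp (hiter n).1 (hiter n).2))
      Metric.isOpen_ball htv
  · exact tsum_of_norm_bounded hvs.hasSum fun n => htv n w hw
  · have hs : Summable fun n => t n w := Summable.of_norm_bounded hvs fun n => htv n w hw
    have hfun : d * T w = Complex.log (u w) + T (F w) := by
      have h0 : d * T w = ∑' n, d * t n w := (tsum_mul_left).symm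
      rw [h0, (hs.mul_left (d : ℂ)).tsum_eq_zero_add]
      congr 1
      · simp only [ht, zero_add, pow_one, Function.iterate_zero, id]
        rw [← mul_assoc, mul_inv_cancel₀ hdC, one_mul]
      · refine tsum_congr fun n => ?_
        simp only [ht, Function.iterate_succ_apply]
        rw [pow_succ (d : ℂ) (n + 1), mul_inv]
        field_simp
    have hune : u w ≠ 0 := div_ne_zero hc0 (hball w (hsub hw)).1
    have hexp : Complex.exp (T w) ^ d = u w * Complex.exp (T (F w)) := by
      rw [← Complex.exp_nat_mul, hfun, Complex.exp_add, Complex.exp_log hune]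
    change Complex.exp (T (F w)) * c = Complex.exp (T w) ^ d * R w
    rw [hexp]
    simp only [hu]
    have := (hball w (hsub hw)).1
    field_simp

/-- The Böttcher coordinate `w ↦ w exp (S w)` at infinity, in the coordinate `w = 1 / z`. -/
theorem exists_bottcher_near_zero (f : Polynomial ℂ) (hf : 2 ≤ f.natDegree) :
    ∃ r : ℝ, 0 < r ∧ r ≤ 1 ∧ ∃ (S : ℂ → ℂ) (C : ℝ), DifferentiableOn ℂ S (Metric.ball 0 r) ∧
      ∀ w ∈ Metric.ball (0 : ℂ) r, ‖S w‖ ≤ C ∧ f.reverse.eval w ≠ 0 ∧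
        ‖w ^ f.natDegree / f.reverse.eval w‖ ≤ ‖w‖ / 2 ∧
        (w ^ f.natDegree / f.reverse.eval w) *
            Complex.exp (S (w ^ f.natDegree / f.reverse.eval w)) =
          (w * Complex.exp (S w)) ^ f.natDegree := by
  have hf0 : f ≠ 0 := by rintro rfl; simp at hf
  obtain ⟨r, hr, hr1, T, C, hT, h⟩ := exists_bottcher_log f hf
  -- Subtracting log α with α^(d-1) equal to the leading coefficient removes that coefficient from
  -- the functional equation.
  obtain ⟨α, hα⟩ := IsAlgClosed.exists_pow_nat_eq f.leadingCoeff
    (show 0 < f.natDegree - 1 by omega)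
  have hc0 : f.leadingCoeff ≠ 0 := by simpa using hf0
  have hα0 : α ≠ 0 := by
    rintro rfl
    rw [zero_pow (by omega)] at hα
    exact hc0 hα.symm
  have hαd : α ^ f.natDegree = α * f.leadingCoeff := by
    rw [← hα, ← pow_succ']; congr 1; omega
  refine ⟨r, hr, hr1, fun w => T w - Complex.log α, C + ‖Complex.log α‖,
    hT.sub_const _, fun w hw => ?_⟩
  obtain ⟨h1, h2, h3, h4⟩ := h w hw
  refine ⟨(norm_sub_le _ _).trans (by linarith), h2, h3, ?_⟩
  simp only [Complex.exp_sub, Complex.exp_log hα0]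
  set E := Complex.exp (T (w ^ f.natDegree / f.reverse.eval w))
  set E' := Complex.exp (T w)
  have h5 : E = E' ^ f.natDegree * f.reverse.eval w / f.leadingCoeff := by
    rw [eq_div_iff hc0, h4]
  rw [h5, mul_pow, div_pow, hαd]
  field_simp

/-- Near infinity the Green function is minus the logarithm of the modulus of the Böttcher
coordinate. -/
theorem green_eq_of_bottcher (f : Polynomial ℂ) (hf : 2 ≤ f.natDegree) {r C : ℝ} (hr : 0 < r)
    (hr1 : r ≤ 1) {S : ℂ → ℂ}
    (h : ∀ w ∈ Metric.ball (0 : ℂ) r, ‖S w‖ ≤ C ∧ f.reverse.eval w ≠ 0 ∧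
        ‖w ^ f.natDegree / f.reverse.eval w‖ ≤ ‖w‖ / 2 ∧
        (w ^ f.natDegree / f.reverse.eval w) *
            Complex.exp (S (w ^ f.natDegree / f.reverse.eval w)) =
          (w * Complex.exp (S w)) ^ f.natDegree)
    {z : ℂ} (hz : r⁻¹ < ‖z‖) : green f z = Real.log ‖z‖ - (S z⁻¹).re := by
  have hd := two_le_cast_natDegree hf
  have hmem : ∀ z : ℂ, r⁻¹ < ‖z‖ → z ≠ 0 ∧ z⁻¹ ∈ Metric.ball (0 : ℂ) r := by
    intro z hz
    refine ⟨norm_pos_iff.1 ((inv_pos.2 hr).trans hz), ?_⟩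
    rw [mem_ball_zero_iff, norm_inv]
    exact inv_lt_of_inv_lt₀ hr hz
  have hinv : ∀ z : ℂ, r⁻¹ < ‖z‖ →
      (f.eval z)⁻¹ = z⁻¹ ^ f.natDegree / f.reverse.eval z⁻¹ := by
    intro z hz
    rw [← eval_reverse_inv_mul_pow f (hmem z hz).1, mul_inv, inv_pow, div_eq_mul_inv, mul_comm]
  have hstep : ∀ z : ℂ, r⁻¹ < ‖z‖ → r⁻¹ < ‖f.eval z‖ := by
    intro z hz
    obtain ⟨-, h2, h3, -⟩ := h _ (hmem z hz).2
    rw [← hinv z hz, norm_inv, norm_inv] at h3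
    have hz0 := (inv_pos.2 hr).trans hz
    have hne : f.eval z ≠ 0 := by
      rw [← eval_reverse_inv_mul_pow f (hmem z hz).1]
      exact mul_ne_zero h2 (pow_ne_zero _ (hmem z hz).1)
    refine hz.trans_le ((inv_le_inv₀ (norm_pos_iff.2 hne) hz0).1 (h3.trans ?_))
    have := inv_pos.2 hz0
    linarith
  set A : ℂ → ℝ := fun z => Real.log ‖z‖ - (S z⁻¹).re with hA
  have hAexp : ∀ z : ℂ, r⁻¹ < ‖z‖ → A z = -Real.log ‖z⁻¹ * Complex.exp (S z⁻¹)‖ := by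
    intro z hz
    rw [norm_mul, Real.log_mul (norm_ne_zero_iff.2 (inv_ne_zero (hmem z hz).1))
      (norm_ne_zero_iff.2 (Complex.exp_ne_zero _)), Complex.norm_exp, Real.log_exp, norm_inv,
      Real.log_inv]
    simp only [hA]
    ring
  have hAf : ∀ z : ℂ, r⁻¹ < ‖z‖ → A (f.eval z) = f.natDegree * A z := by
    intro z hz
    rw [hAexp _ (hstep z hz), hAexp z hz, hinv z hz, (h _ (hmem z hz).2).2.2.2, norm_pow,
      Real.log_pow]
    ring
  obtain ⟨C', hC'⟩ := exists_abs_green_sub_posLog_le f hf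
  have hbound : ∀ z : ℂ, r⁻¹ < ‖z‖ → |green f z - A z| ≤ C' + C := by
    intro z hz
    have h1 : Real.posLog ‖z‖ = Real.log ‖z‖ := by
      apply Real.posLog_eq_log
      rw [abs_of_nonneg (norm_nonneg _)]
      exact (one_le_inv₀ hr).2 hr1 |>.trans hz.le
    have h2 := hC' z
    have h3 := (Complex.abs_re_le_norm _).trans (h _ (hmem z hz).2).1
    rw [h1] at h2
    have : green f z - A z = (green f z - Real.log ‖z‖) + (S z⁻¹).re := by simp only [hA]; ring
    rw [this]
    exact (abs_add_le _ _).trans (add_le_add h2 h3)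
  -- Both the Green function and A are multiplied by d under f, so their bounded difference would
  -- grow like d^n unless it vanished.
  have hiter : ∀ n : ℕ, ∀ z : ℂ, r⁻¹ < ‖z‖ →
      (f.natDegree : ℝ) ^ n * |green f z - A z| ≤ C' + C := by
    intro n
    induction n with
    | zero => intro z hz; simpa using hbound z hz
    | succ n ih =>
      intro z hz
      have := ih _ (hstep z hz)
      rw [green_eval f hf, hAf z hz, ← mul_sub, abs_mul, abs_of_pos (by linarith : (0 : ℝ) < _)]
        at this
      rw [pow_succ, mul_assoc]
      exact this
  by_contra hne
  have hpos : 0 < |green f z - A z| := abs_pos.2 (sub_ne_zero.2 hne)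
  have hlim := (tendsto_pow_atTop_atTop_of_one_lt (by linarith : (1 : ℝ) < f.natDegree)).atTop_mul_const hpos
  obtain ⟨n, hn⟩ := (hlim.eventually (eventually_gt_atTop (C' + C))).exists
  exact absurd (hiter n z hz) (not_le.2 hn)

/-- A Böttcher coordinate `coord` of `f` on `{G_f > M}`, and the parametrisation `param` of this
domain by the half-plane `{Re s > M}` for which `coord (param s) = exp (-s)`. -/
structure BottcherChart (f : Polynomial ℂ) where
  M : ℝ
  coord : ℂ → ℂ
  param : ℂ → ℂ
  M_pos : 0 < M
  continuousOn_coord : ContinuousOn coord {z | M < green f z}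
  injOn_coord : Set.InjOn coord {z | M < green f z}
  norm_coord : ∀ z, M < green f z → ‖coord z‖ = Real.exp (-green f z)
  coord_eval : ∀ z, M < green f z → coord (f.eval z) = coord z ^ f.natDegree
  contDiffAt_green : ∀ z, M < green f z → ContDiffAt ℝ 1 (green f) z
  differentiableAt_param : ∀ s : ℂ, M < s.re → DifferentiableAt ℂ param s
  green_param : ∀ s : ℂ, M < s.re → green f (param s) = s.re
  coord_param : ∀ s : ℂ, M < s.re → coord (param s) = Complex.exp (-s)

/-- The map b(w) = w exp(S(w)) fixes 0 with derivative exp(S(0)) ≠ 0, so the inverse function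
theorem provides a holomorphic local inverse. Then `coord` is z ↦ b(1/z), and `param` is
1/b⁻¹(exp(-s)). -/
theorem nonempty_bottcherChart (f : Polynomial ℂ) (hf : 2 ≤ f.natDegree) :
    Nonempty (BottcherChart f) := by
  obtain ⟨r, hr, hr1, S, C, hS, h⟩ := exists_bottcher_near_zero f hf
  have hgreen := fun z (hz : r⁻¹ < ‖z‖) => green_eq_of_bottcher f hf hr hr1 h hz
  have h0r : (0 : ℂ) ∈ Metric.ball (0 : ℂ) r := Metric.mem_ball_self hr
  have hSan : ∀ w ∈ Metric.ball (0 : ℂ) r, ContDiffAt ℂ 1 S w := fun w hw =>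
    (hS.analyticAt (Metric.isOpen_ball.mem_nhds hw)).contDiffAt
  set b : ℂ → ℂ := fun w => w * Complex.exp (S w) with hb
  have hbc : ∀ w ∈ Metric.ball (0 : ℂ) r, ContDiffAt ℂ 1 b w := fun w hw =>
    contDiffAt_id.mul (hSan w hw).cexp
  have hb0 : b 0 = 0 := by simp [hb]
  have hbd : HasDerivAt b (Complex.exp (S 0)) 0 := by
    have h1 : HasDerivAt b
        (1 * Complex.exp (S 0) + 0 * (Complex.exp (S 0) * deriv S 0)) 0 :=
      (hasDerivAt_id (0 : ℂ)).mul
        ((hS.differentiableAt (Metric.isOpen_ball.mem_nhds h0r)).hasDerivAt.cexp)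
    rwa [one_mul, zero_mul, add_zero] at h1
  have hbf : HasFDerivAt b
      ((ContinuousLinearEquiv.unitsEquivAut ℂ (Units.mk0 _ (Complex.exp_ne_zero (S 0))) :
        ℂ ≃L[ℂ] ℂ) : ℂ →L[ℂ] ℂ) 0 := by
    convert! hbd.hasFDerivAt using 1
  set e := (hbc 0 h0r).toOpenPartialHomeomorph b hbf one_ne_zero with he
  have hecoe : ∀ w, e w = b w := fun w => rfl
  have hesrc : (0 : ℂ) ∈ e.source :=
    (hbc 0 h0r).mem_toOpenPartialHomeomorph_source hbf one_ne_zero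
  have hetgt : (0 : ℂ) ∈ e.target := by
    have := (hbc 0 h0r).image_mem_toOpenPartialHomeomorph_target hbf one_ne_zero
    rwa [hb0] at this
  have hesymm0 : e.symm 0 = 0 := by
    have := e.left_inv hesrc
    rwa [hecoe, hb0] at this
  have hsymm : ContDiffAt ℂ 1 e.symm 0 := by
    refine e.contDiffAt_symm hetgt (f₀' := ContinuousLinearEquiv.unitsEquivAut ℂ
      (Units.mk0 _ (Complex.exp_ne_zero (S 0)))) ?_ ?_
    · rw [hesymm0]; exact hbf
    · rw [hesymm0]; exact hbc 0 h0r
  obtain ⟨δ, hδ, hδsub⟩ := Metric.mem_nhds_iff.1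
    (Filter.inter_mem (e.open_source.mem_nhds hesrc) (Metric.ball_mem_nhds (0 : ℂ) hr))
  have hev : ∀ᶠ ζ in 𝓝 (0 : ℂ), ζ ∈ e.target ∧ DifferentiableAt ℂ e.symm ζ ∧
      e.symm ζ ∈ Metric.ball (0 : ℂ) δ := by
    refine (e.open_target.eventually_mem hetgt).and (((hsymm.eventually (by simp)).mono
      fun ζ hζ => hζ.differentiableAt one_ne_zero).and ?_)
    refine hsymm.continuousAt.eventually_mem ?_
    rw [hesymm0]
    exact Metric.ball_mem_nhds _ hδ
  obtain ⟨ε, hε, hεball⟩ := Metric.eventually_nhds_iff_ball.1 hev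
  obtain ⟨M₀, hM₀, hM₀norm⟩ := exists_norm_gt_of_green_gt f hf δ⁻¹
  -- The first bound places 1/z in the ball where b is injective; the second places exp(-s) in the
  -- ball where the inverse of b is holomorphic.
  set M := max M₀ (-Real.log ε) with hM
  have hbig : ∀ z : ℂ, M < green f z → z ≠ 0 ∧ z⁻¹ ∈ Metric.ball (0 : ℂ) δ := by
    intro z hz
    have h1 := hM₀norm z ((le_max_left _ _).trans_lt hz)
    refine ⟨norm_pos_iff.1 ((inv_pos.2 hδ).trans h1), ?_⟩
    rw [mem_ball_zero_iff, norm_inv]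
    exact inv_lt_of_inv_lt₀ hδ h1
  have hnormr : ∀ z : ℂ, z ≠ 0 → z⁻¹ ∈ Metric.ball (0 : ℂ) δ → r⁻¹ < ‖z‖ := by
    intro z hz0 hz
    have := (hδsub hz).2
    rw [mem_ball_zero_iff, norm_inv] at this
    exact inv_lt_of_inv_lt₀ (norm_pos_iff.2 hz0) this
  have hnorm : ∀ z : ℂ, r⁻¹ < ‖z‖ → ‖b z⁻¹‖ = Real.exp (-green f z) := by
    intro z hz
    rw [hgreen z hz, neg_sub, sub_eq_add_neg, Real.exp_add, Real.exp_neg, Real.exp_log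
      ((inv_pos.2 hr).trans hz), hb]
    simp only [norm_mul, Complex.norm_exp, norm_inv]
    ring
  have hexp : ∀ s : ℂ, M < s.re → Complex.exp (-s) ∈ Metric.ball (0 : ℂ) ε := by
    intro s hs
    rw [mem_ball_zero_iff, Complex.norm_exp, Complex.neg_re, ← Real.lt_log_iff_exp_lt hε]
    linarith [(le_max_right M₀ (-Real.log ε)).trans_lt hs]
  have hsymmb : ∀ s : ℂ, M < s.re → b (e.symm (Complex.exp (-s))) = Complex.exp (-s) :=
    fun s hs => e.right_inv (hεball _ (hexp s hs)).1
  have hsymmne : ∀ s : ℂ, M < s.re → e.symm (Complex.exp (-s)) ≠ 0 := by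
    intro s hs h0
    have := hsymmb s hs
    rw [h0, hb0] at this
    exact Complex.exp_ne_zero _ this.symm
  refine ⟨⟨M, fun z => b z⁻¹, fun s => (e.symm (Complex.exp (-s)))⁻¹,
    hM₀.trans_le (le_max_left _ _), ?_, ?_, ?_, ?_, ?_, ?_, ?_, ?_⟩⟩
  · intro z hz
    obtain ⟨hz0, hzδ⟩ := hbig z hz
    exact ((hbc _ (hδsub hzδ).2).continuousAt.comp (continuousAt_inv₀ hz0)).continuousWithinAt
  · intro z hz z' hz' heq
    exact inv_injective (e.injOn (hδsub (hbig z hz).2).1 (hδsub (hbig z' hz').2).1 heq)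
  · intro z hz
    obtain ⟨hz0, hzδ⟩ := hbig z hz
    exact hnorm z (hnormr z hz0 hzδ)
  · intro z hz
    obtain ⟨hz0, hzδ⟩ := hbig z hz
    have h4 := (h _ (hδsub hzδ).2).2.2.2
    have hinv : (f.eval z)⁻¹ = z⁻¹ ^ f.natDegree / f.reverse.eval z⁻¹ := by
      rw [← eval_reverse_inv_mul_pow f hz0, mul_inv, inv_pow, div_eq_mul_inv, mul_comm]
    simp only [hb]
    rw [hinv, h4]
  · intro z hz
    obtain ⟨hz0, hzδ⟩ := hbig z hz
    have hzr := hnormr z hz0 hzδ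
    have heq : green f =ᶠ[𝓝 z] fun z => Real.log ‖z‖ - (S z⁻¹).re := by
      filter_upwards [(isOpen_lt continuous_const continuous_norm).mem_nhds hzr] with w hw
      exact hgreen w hw
    refine ContDiffAt.congr_of_eventuallyEq ?_ heq
    refine (((contDiffAt_norm ℝ hz0).log (norm_ne_zero_iff.2 hz0))).sub ?_
    have h1 : ContDiffAt ℂ 1 (fun z : ℂ => S z⁻¹) z :=
      ContDiffAt.comp z (hSan _ (hδsub hzδ).2) (contDiffAt_inv ℂ hz0)
    exact Complex.reCLM.contDiff.contDiffAt.comp z (h1.restrict_scalars ℝ)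
  · intro s hs
    exact ((hεball _ (hexp s hs)).2.1.comp s (by fun_prop)).inv (hsymmne s hs)
  · intro s hs
    have h1 := (hεball _ (hexp s hs)).2.2
    have h2 := hnorm _ (hnormr _ (inv_ne_zero (hsymmne s hs)) (by rwa [inv_inv]))
    rw [inv_inv, hsymmb s hs, Complex.norm_exp] at h2
    simpa using (Real.exp_injective h2).symm
  · intro s hs
    simp only [inv_inv]
    exact hsymmb s hs

/-- The Green function increases along horizontal lines in a half-strip. -/
theorem exists_fderiv_green_one_nonneg (f : Polynomial ℂ) (hf : 2 ≤ f.natDegree) :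
    ∃ R : ℝ, ∀ z : ℂ, R ≤ z.re → 0 ≤ fderiv ℝ (green f) z 1 := by
  obtain ⟨r, hr, hr1, S, C, hS, h⟩ := exists_bottcher_near_zero f hf
  have hgreen := fun z (hz : r⁻¹ < ‖z‖) => green_eq_of_bottcher f hf hr hr1 h hz
  have h0r : (0 : ℂ) ∈ Metric.ball (0 : ℂ) r := Metric.mem_ball_self hr
  have hcont : ContinuousAt (deriv S) 0 :=
    (hS.analyticAt (Metric.isOpen_ball.mem_nhds h0r)).deriv.continuousAt
  have hev : ∀ᶠ w in 𝓝 (0 : ℂ), ‖deriv S w‖ < ‖deriv S 0‖ + 1 ∧ w ∈ Metric.ball (0 : ℂ) r :=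
    (hcont.norm.eventually_lt continuousAt_const (lt_add_one _)).and (Metric.ball_mem_nhds _ hr)
  obtain ⟨δ, hδ, hball⟩ := Metric.eventually_nhds_iff_ball.1 hev
  -- Here G = Re(log z - S(1/z)) has horizontal derivative Re(1/z) + Re(S'(1/z)/z²). The first term
  -- is Re z/|z|², which dominates the second once Re z exceeds a bound for |S'| near 0.
  refine ⟨max (δ⁻¹ + 1) (‖deriv S 0‖ + 1), fun z hz => ?_⟩
  have hz1 : δ⁻¹ < z.re := by linarith [(le_max_left _ _).trans hz]
  have hz2 : ‖deriv S 0‖ + 1 ≤ z.re := (le_max_right _ _).trans hz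
  have hzre : 0 < z.re := (inv_pos.2 hδ).trans hz1
  have hznorm : δ⁻¹ < ‖z‖ := hz1.trans_le ((le_abs_self _).trans (Complex.abs_re_le_norm z))
  have hz0 : z ≠ 0 := norm_pos_iff.1 ((inv_pos.2 hδ).trans hznorm)
  have hzi : z⁻¹ ∈ Metric.ball (0 : ℂ) δ := by
    rw [mem_ball_zero_iff, norm_inv]
    exact inv_lt_of_inv_lt₀ hδ hznorm
  obtain ⟨hd, hzr⟩ := hball _ hzi
  have hzr' : r⁻¹ < ‖z‖ := by
    rw [mem_ball_zero_iff, norm_inv] at hzr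
    exact inv_lt_of_inv_lt₀ (norm_pos_iff.2 hz0) hzr
  have heq : green f =ᶠ[𝓝 z] fun z => (Complex.log z - S z⁻¹).re := by
    filter_upwards [(isOpen_lt continuous_const continuous_norm).mem_nhds hzr'] with w hw
    rw [hgreen w hw, Complex.sub_re, Complex.log_re]
  have hΦ : HasDerivAt (fun z => Complex.log z - S z⁻¹)
      (z⁻¹ - deriv S z⁻¹ * -(z ^ 2)⁻¹) z :=
    (Complex.hasDerivAt_log (Or.inl hzre)).sub
      ((hS.differentiableAt (Metric.isOpen_ball.mem_nhds hzr)).hasDerivAt.comp z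
        (hasDerivAt_inv hz0))
  have hG : HasFDerivAt (green f) (Complex.reCLM.comp
      ((ContinuousLinearMap.toSpanSingleton ℂ
        (z⁻¹ - deriv S z⁻¹ * -(z ^ 2)⁻¹)).restrictScalars ℝ)) z :=
    (Complex.reCLM.hasFDerivAt.comp z (hΦ.hasFDerivAt.restrictScalars ℝ)).congr_of_eventuallyEq heq
  rw [hG.fderiv]
  have h1 : ‖deriv S z⁻¹ * (z ^ 2)⁻¹‖ ≤ z.re / ‖z‖ ^ 2 := by
    rw [norm_mul, norm_inv, norm_pow, ← div_eq_mul_inv]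
    gcongr
    linarith
  have h2 : (z⁻¹).re = z.re / ‖z‖ ^ 2 := by rw [Complex.inv_re, Complex.normSq_eq_norm_sq]
  have h3 := (abs_le.1 (Complex.abs_re_le_norm (deriv S z⁻¹ * (z ^ 2)⁻¹))).1
  have h4 : (Complex.reCLM.comp ((ContinuousLinearMap.toSpanSingleton ℂ
        (z⁻¹ - deriv S z⁻¹ * -(z ^ 2)⁻¹)).restrictScalars ℝ)) 1 =
      (z⁻¹).re + (deriv S z⁻¹ * (z ^ 2)⁻¹).re := by
    simp
  rw [h4, h2]
  linarith

/-! ### Dynamics in the half-plane parametrisation -/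

namespace BottcherChart

variable {f : Polynomial ℂ} (c : BottcherChart f)

theorem coord_ne_zero {z : ℂ} (hz : c.M < green f z) : c.coord z ≠ 0 := by
  rw [← norm_pos_iff, c.norm_coord z hz]
  exact Real.exp_pos _

theorem M_lt_green_param {s : ℂ} (hs : c.M < s.re) : c.M < green f (c.param s) := by
  rwa [c.green_param s hs]

theorem exists_param_eq {z : ℂ} (hz : c.M < green f z) :
    ∃ s : ℂ, s.re = green f z ∧ c.param s = z := by
  have h0 := c.coord_ne_zero hz
  have hre : (-Complex.log (c.coord z)).re = green f z := by
    rw [Complex.neg_re, Complex.log_re, c.norm_coord z hz, Real.log_exp, neg_neg]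
  refine ⟨-Complex.log (c.coord z), hre, ?_⟩
  have hM : c.M < (-Complex.log (c.coord z)).re := by rwa [hre]
  refine c.injOn_coord (c.M_lt_green_param hM) hz ?_
  rw [c.coord_param _ hM, neg_neg, Complex.exp_log h0]

theorem param_eq_of_exp_eq {s t : ℂ} (hs : c.M < s.re) (ht : c.M < t.re)
    (h : Complex.exp (-s) = Complex.exp (-t)) : c.param s = c.param t := by
  refine c.injOn_coord (c.M_lt_green_param hs) (c.M_lt_green_param ht) ?_
  rw [c.coord_param s hs, c.coord_param t ht, h]

theorem exp_eq_of_param_eq {s t : ℂ} (hs : c.M < s.re) (ht : c.M < t.re)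
    (h : c.param s = c.param t) : Complex.exp (-s) = Complex.exp (-t) := by
  rw [← c.coord_param s hs, ← c.coord_param t ht, h]

theorem M_lt_natDegree_mul_re (hf : 2 ≤ f.natDegree) {s : ℂ} (hs : c.M < s.re) :
    c.M < ((f.natDegree : ℂ) * s).re := by
  have hd := two_le_cast_natDegree hf
  have : ((f.natDegree : ℂ) * s).re = f.natDegree * s.re := by simp
  rw [this]
  nlinarith [c.M_pos]

theorem eval_param (hf : 2 ≤ f.natDegree) {s : ℂ} (hs : c.M < s.re) :
    f.eval (c.param s) = c.param (f.natDegree * s) := by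
  have hds := c.M_lt_natDegree_mul_re hf hs
  refine c.injOn_coord ?_ (c.M_lt_green_param hds) ?_
  · change c.M < _
    have : ((f.natDegree : ℂ) * s).re = f.natDegree * s.re := by simp
    rw [green_eval f hf, c.green_param s hs, ← this]
    exact hds
  · rw [c.coord_eval _ (c.M_lt_green_param hs), c.coord_param s hs, c.coord_param _ hds,
      ← Complex.exp_nat_mul]
    ring_nf

theorem iterate_param (hf : 2 ≤ f.natDegree) {s : ℂ} (hs : c.M < s.re) (n : ℕ) :
    (fun w => f.eval w)^[n] (c.param s) = c.param ((f.natDegree : ℂ) ^ n * s) ∧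
      c.M < ((f.natDegree : ℂ) ^ n * s).re := by
  induction n with
  | zero => simpa using hs
  | succ n ih =>
    have e : (f.natDegree : ℂ) ^ (n + 1) * s = f.natDegree * ((f.natDegree : ℂ) ^ n * s) := by
      ring
    rw [Function.iterate_succ_apply', ih.1, c.eval_param hf ih.2, e]
    exact ⟨rfl, c.M_lt_natDegree_mul_re hf ih.2⟩

theorem iterate_coord (hf : 2 ≤ f.natDegree) {z : ℂ} (hz : c.M < green f z) (n : ℕ) :
    c.coord ((fun w => f.eval w)^[n] z) = c.coord z ^ f.natDegree ^ n := by
  obtain ⟨s, hs, rfl⟩ := c.exists_param_eq hz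
  rw [← hs] at hz
  obtain ⟨h1, h2⟩ := c.iterate_param hf hz n
  rw [h1, c.coord_param _ h2, c.coord_param _ hz, ← Complex.exp_nat_mul]
  push_cast
  ring_nf

theorem param_mem_basin (hf : 2 ≤ f.natDegree) {s : ℂ} (hs : c.M < s.re) :
    c.param s ∈ basin f := by
  rw [mem_basin_iff f hf]
  exact c.M_pos.trans (c.M_lt_green_param hs)

theorem param_add_two_pi (s : ℂ) (hs : c.M < s.re) (k : ℤ) :
    c.param (s + Complex.I * (2 * Real.pi * k : ℝ)) = c.param s := by
  refine c.param_eq_of_exp_eq (by simpa using hs) hs ?_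
  refine Complex.exp_eq_exp_iff_exists_int.2 ⟨-k, ?_⟩
  push_cast
  ring

end BottcherChart

/-! ### Semiconjugacies preserve level sets and the order of potentials -/

/-- `F` semiconjugates `f` on its basin to `g` on its basin. -/
structure IsSemiconj (f g : Polynomial ℂ) (F : ℂ → ℂ) : Prop where
  continuousOn : ContinuousOn F (basin f)
  mapsTo : Set.MapsTo F (basin f) (basin g)
  map_eval : ∀ z ∈ basin f, F (f.eval z) = g.eval (F z)

theorem iterate_mem_basin (f : Polynomial ℂ) {z : ℂ} (hz : z ∈ basin f) (n : ℕ) :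
    (fun w => f.eval w)^[n] z ∈ basin f := by
  induction n with
  | zero => exact hz
  | succ n ih => rw [Function.iterate_succ_apply']; exact eval_mem_basin f ih

theorem IsSemiconj.map_iterate {f g : Polynomial ℂ} {F : ℂ → ℂ} (hF : IsSemiconj f g F)
    {z : ℂ} (hz : z ∈ basin f) (n : ℕ) :
    F ((fun w => f.eval w)^[n] z) = (fun w => g.eval w)^[n] (F z) := by
  induction n with
  | zero => rfl
  | succ n ih =>
    rw [Function.iterate_succ_apply', Function.iterate_succ_apply', ← ih,
      hF.map_eval _ (iterate_mem_basin f hz n)]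

/-- These are the angles forgotten by some iterate of w ↦ w^d. Identities checked on them extend by
continuity to all rotations of a level curve. -/
theorem dense_two_pi_mul_div_pow {d : ℕ} (hd : 2 ≤ d) :
    Dense {r : ℝ | ∃ (j : ℤ) (n : ℕ), r = 2 * Real.pi * j / (d : ℝ) ^ n} := by
  have hd2 : (2 : ℝ) ≤ d := by exact_mod_cast hd
  refine Metric.dense_iff.2 fun x ε hε => ?_
  have hlim : Tendsto (fun n : ℕ => 2 * Real.pi * ((d : ℝ)⁻¹) ^ n) atTop (𝓝 0) := by
    simpa using (tendsto_pow_atTop_nhds_zero_of_lt_one (by positivity)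
      (inv_lt_one_of_one_lt₀ (by linarith : (1 : ℝ) < d))).const_mul (2 * Real.pi)
  obtain ⟨n, hn⟩ := (hlim.eventually (gt_mem_nhds hε)).exists
  set a : ℝ := 2 * Real.pi * ((d : ℝ)⁻¹) ^ n with ha
  have hapos : 0 < a := by positivity
  refine ⟨a * ⌊x / a⌋, ?_, ⌊x / a⌋, n, ?_⟩
  · rw [Metric.mem_ball, Real.dist_eq, abs_lt]
    have h1 := Int.floor_le (x / a)
    have h2 := Int.lt_floor_add_one (x / a)
    rw [le_div_iff₀ hapos] at h1
    rw [div_lt_iff₀ hapos] at h2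
    constructor <;> nlinarith
  · rw [ha, inv_pow]
    ring

section Semiconj

variable {f g : Polynomial ℂ} {F : ℂ → ℂ}

theorem IsSemiconj.continuous_vertical (hF : IsSemiconj f g F) (hf : 2 ≤ f.natDegree)
    (c : BottcherChart f) {s : ℂ} (hs : c.M < s.re) :
    Continuous fun y : ℝ => F (c.param (s + Complex.I * y)) := by
  refine continuous_iff_continuousAt.2 fun y => ?_
  have hy : c.M < (s + Complex.I * y).re := by simpa using hs
  have h1 : ContinuousAt F (c.param (s + Complex.I * y)) :=
    hF.continuousOn.continuousAt ((isOpen_basin f hf).mem_nhds (c.param_mem_basin hf hy))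
  exact ContinuousAt.comp (f := fun y : ℝ => c.param (s + Complex.I * y)) h1
    (ContinuousAt.comp (f := fun y : ℝ => s + Complex.I * (y : ℂ))
      (c.differentiableAt_param _ hy).continuousAt (by fun_prop))

/-- Points of a level curve differing by an angle `2πj/dⁿ` have the same `n`-th iterate. -/
theorem IsSemiconj.iterate_vertical (hF : IsSemiconj f g F) (hf : 2 ≤ f.natDegree)
    (c : BottcherChart f) {s : ℂ} (hs : c.M < s.re) (y : ℝ) (j : ℤ) (n : ℕ) :
    (fun w => g.eval w)^[n] (F (c.param
        (s + Complex.I * (y + 2 * Real.pi * j / (f.natDegree : ℝ) ^ n : ℝ)))) =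
      (fun w => g.eval w)^[n] (F (c.param (s + Complex.I * y))) := by
  have hy : ∀ y : ℝ, c.M < (s + Complex.I * y).re := fun y => by simpa using hs
  have hd : (f.natDegree : ℂ) ≠ 0 := by
    have : f.natDegree ≠ 0 := by omega
    exact_mod_cast this
  rw [← hF.map_iterate (c.param_mem_basin hf (hy _)), ← hF.map_iterate (c.param_mem_basin hf (hy _)),
    (c.iterate_param hf (hy _) n).1, (c.iterate_param hf (hy _) n).1,
    ← c.param_add_two_pi _ (c.iterate_param hf (hy y) n).2 j]
  congr 2
  push_cast
  field_simp
  ring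

theorem IsSemiconj.green_iterate_map (hF : IsSemiconj f g F)
    (hg : 2 ≤ g.natDegree) {z : ℂ} (hz : z ∈ basin f) (n : ℕ) :
    green g (F ((fun w => f.eval w)^[n] z)) = (g.natDegree : ℝ) ^ n * green g (F z) := by
  rw [hF.map_iterate hz, green_iterate g hg]

/-- At the dense set of angles 2πj/d^n the images have a common n-th iterate under g, and G_g ∘ gⁿ
is a nonzero multiple of G_g. -/
theorem IsSemiconj.green_vertical (hF : IsSemiconj f g F) (hf : 2 ≤ f.natDegree)
    (hg : 2 ≤ g.natDegree) (c : BottcherChart f) {s : ℂ} (hs : c.M < s.re) (y : ℝ) :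
    green g (F (c.param (s + Complex.I * y))) = green g (F (c.param s)) := by
  have hgd : (g.natDegree : ℝ) ≠ 0 := by
    have := two_le_cast_natDegree hg
    linarith
  have hcont : Continuous fun y : ℝ => green g (F (c.param (s + Complex.I * y))) :=
    (continuous_green g hg).comp (hF.continuous_vertical hf c hs)
  have h := hcont.ext_on (dense_two_pi_mul_div_pow hf)
    (continuous_const (y := green g (F (c.param s)))) ?_
  · exact congrFun h y
  · rintro r ⟨j, n, rfl⟩
    have h1 := hF.iterate_vertical hf c hs 0 j n
    have h2 := congrArg (green g) h1
    rw [green_iterate g hg, green_iterate g hg] at h2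
    have h3 := mul_left_cancel₀ (pow_ne_zero n hgd) h2
    simpa using h3

theorem exists_lt_pow_mul {d M a b : ℝ} (hd : 2 ≤ d) (ha : 0 < a) (hb : 0 < b) :
    ∃ n : ℕ, M < d ^ n * a ∧ M < d ^ n * b := by
  have h := tendsto_pow_atTop_atTop_of_one_lt (by linarith : 1 < d)
  exact (((h.atTop_mul_const ha).eventually_gt_atTop M).and
    ((h.atTop_mul_const hb).eventually_gt_atTop M)).exists

/-- A semiconjugacy sends level sets of the Green function to level sets. -/
theorem IsSemiconj.green_eq_of_green_eq (hF : IsSemiconj f g F) (hf : 2 ≤ f.natDegree)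
    (hg : 2 ≤ g.natDegree) {z₁ z₂ : ℂ} (h₁ : z₁ ∈ basin f) (h₂ : z₂ ∈ basin f)
    (h : green f z₁ = green f z₂) : green g (F z₁) = green g (F z₂) := by
  obtain ⟨c⟩ := nonempty_bottcherChart f hf
  have hgd : (g.natDegree : ℝ) ≠ 0 := by
    have := two_le_cast_natDegree hg
    linarith
  -- A common iterate moves both points into the chart, onto the same vertical line; the resulting
  -- equality is divided by the n-th power of the degree of g.
  obtain ⟨n, hn, -⟩ := exists_lt_pow_mul (M := c.M) (two_le_cast_natDegree hf)
    ((mem_basin_iff f hf z₁).1 h₁) one_pos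
  have hn2 := hn
  rw [h] at hn2
  rw [← green_iterate f hf] at hn hn2
  obtain ⟨s₁, hs₁, e₁⟩ := c.exists_param_eq hn
  obtain ⟨s₂, hs₂, e₂⟩ := c.exists_param_eq hn2
  have hre : s₂.re = s₁.re := by
    rw [hs₁, hs₂, green_iterate f hf, green_iterate f hf, h]
  have hs : s₂ = s₁ + Complex.I * (s₂.im - s₁.im : ℝ) := by
    apply Complex.ext <;> simp [hre]
  have key := hF.green_vertical hf hg c (by rwa [hs₁] : c.M < s₁.re) (s₂.im - s₁.im)
  rw [← hs, e₁, e₂, hF.green_iterate_map hg h₁, hF.green_iterate_map hg h₂] at key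
  exact (mul_left_cancel₀ (pow_ne_zero n hgd) key).symm

/-- An injective effect on potentials that sends level sets to level sets is increasing. -/
theorem IsSemiconj.green_lt_of_green_lt (hF : IsSemiconj f g F) (hf : 2 ≤ f.natDegree)
    (hg : 2 ≤ g.natDegree)
    (hinj : ∀ z₁ ∈ basin f, ∀ z₂ ∈ basin f, green g (F z₁) = green g (F z₂) →
      green f z₁ = green f z₂)
    {z₁ z₂ : ℂ} (h₁ : z₁ ∈ basin f) (h₂ : z₂ ∈ basin f)
    (h : green f z₁ < green f z₂) : green g (F z₁) < green g (F z₂) := by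
  obtain ⟨c⟩ := nonempty_bottcherChart f hf
  have hfd := two_le_cast_natDegree hf
  have hgd := two_le_cast_natDegree hg
  -- This is the potential of the image as a function of the source potential M + exp t. The
  -- exponential makes the domain all of ℝ, where a continuous injection is strictly monotone.
  set k : ℝ → ℝ := fun t => green g (F (c.param ((c.M + Real.exp t : ℝ) : ℂ))) with hk
  have hM : ∀ t : ℝ, c.M < ((c.M + Real.exp t : ℝ) : ℂ).re := fun t => by
    rw [Complex.ofReal_re]
    linarith [Real.exp_pos t]
  have hkc : Continuous k := by
    refine (continuous_green g hg).comp (continuous_iff_continuousAt.2 fun t => ?_)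
    exact ContinuousAt.comp (f := fun t : ℝ => c.param ((c.M + Real.exp t : ℝ) : ℂ))
      (hF.continuousOn.continuousAt ((isOpen_basin f hf).mem_nhds (c.param_mem_basin hf (hM t))))
      (ContinuousAt.comp (f := fun t : ℝ => ((c.M + Real.exp t : ℝ) : ℂ))
        (c.differentiableAt_param _ (hM t)).continuousAt (by fun_prop))
  have hkinj : Function.Injective k := by
    intro t u htu
    have := hinj _ (c.param_mem_basin hf (hM t)) _ (c.param_mem_basin hf (hM u)) htu
    rw [c.green_param _ (hM t), c.green_param _ (hM u),
      Complex.ofReal_re, Complex.ofReal_re] at this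
    simpa only [add_right_inj, Real.exp_eq_exp] using this
  have hkg : ∀ z ∈ basin f, c.M < green f z →
      k (Real.log (green f z - c.M)) = green g (F z) := by
    intro z hz hzM
    refine hF.green_eq_of_green_eq hf hg (c.param_mem_basin hf (hM _)) hz ?_
    rw [c.green_param _ (hM _), Real.exp_log (by linarith), Complex.ofReal_re]
    ring
  have hmono : StrictMono k := by
    -- A decreasing k is impossible: passing from z to f(z) raises the potential of z and also that
    -- of F(z).
    refine (hkc.strictMono_of_inj hkinj).resolve_right fun hanti => ?_
    have hb := c.param_mem_basin hf (hM 0)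
    have hg1 := c.M_lt_green_param (hM 0)
    set z := c.param ((c.M + Real.exp 0 : ℝ) : ℂ)
    have hpos : 0 < green f z := c.M_pos.trans hg1
    have hlt : green f z < green f (f.eval z) := by
      rw [green_eval f hf]; nlinarith
    have hlog : Real.log (green f z - c.M) < Real.log (green f (f.eval z) - c.M) :=
      Real.log_lt_log (by linarith) (by linarith)
    have h1 := hanti hlog
    rw [hkg _ hb hg1, hkg _ (eval_mem_basin f hb) (hg1.trans hlt), hF.map_eval _ hb,
      green_eval g hg] at h1
    have := (mem_basin_iff g hg _).1 (hF.mapsTo hb)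
    nlinarith
  obtain ⟨n, hn1, hn2⟩ := exists_lt_pow_mul (M := c.M) hfd
    ((mem_basin_iff f hf z₁).1 h₁) ((mem_basin_iff f hf z₂).1 h₂)
  have hlt : (f.natDegree : ℝ) ^ n * green f z₁ < (f.natDegree : ℝ) ^ n * green f z₂ := by gcongr
  rw [← green_iterate f hf] at hn1 hn2
  rw [← green_iterate f hf, ← green_iterate f hf] at hlt
  have h1 := hmono (Real.log_lt_log (by linarith) (by linarith) :
    Real.log (green f ((fun w => f.eval w)^[n] z₁) - c.M) <
      Real.log (green f ((fun w => f.eval w)^[n] z₂) - c.M))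
  rw [hkg _ (iterate_mem_basin f h₁ n) hn1, hkg _ (iterate_mem_basin f h₂ n) hn2,
    hF.green_iterate_map hg h₁, hF.green_iterate_map hg h₂] at h1
  exact lt_of_mul_lt_mul_left h1 (by positivity)

end Semiconj

/-! ### Homeomorphic conjugacies -/

section Conjugacy

variable {f g : Polynomial ℂ} {φ : basin f ≃ₜ basin g}

theorem extendZero_apply {U V : Set ℂ} (φ : U → V) (z : U) : extendZero φ z = φ z :=
  Subtype.val_injective.extend_apply _ _ _

theorem extendZero_of_mem {U V : Set ℂ} (φ : U → V) {z : ℂ} (hz : z ∈ U) :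
    extendZero φ z = φ ⟨z, hz⟩ := extendZero_apply φ ⟨z, hz⟩

theorem IsConjugacy.isSemiconj (hφ : IsConjugacy f g φ) : IsSemiconj f g (extendZero φ) where
  continuousOn := by
    rw [continuousOn_iff_continuous_domRestrict]
    have : (basin f).domRestrict (extendZero φ) = fun z => (φ z : ℂ) := by
      ext z; exact extendZero_apply φ z
    rw [this]
    exact continuous_subtype_val.comp φ.continuous
  mapsTo z hz := by
    rw [extendZero_of_mem φ hz]
    exact (φ ⟨z, hz⟩).2
  map_eval z hz := by
    rw [extendZero_of_mem φ hz, extendZero_of_mem φ (eval_mem_basin f hz)]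
    exact congrArg Subtype.val (hφ ⟨z, hz⟩)

theorem IsConjugacy.symm (hφ : IsConjugacy f g φ) : IsConjugacy g f φ.symm := fun z => by
  rw [φ.symm_apply_eq, hφ, φ.apply_symm_apply]

theorem injOn_extendZero : Set.InjOn (extendZero φ) (basin f) := by
  intro z hz w hw h
  rw [extendZero_of_mem φ hz, extendZero_of_mem φ hw] at h
  exact congrArg Subtype.val (φ.injective (Subtype.ext h))

theorem IsConjugacy.green_eq_iff (hφ : IsConjugacy f g φ) (hf : 2 ≤ f.natDegree)
    (hg : 2 ≤ g.natDegree) (z w : basin f) :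
    green f z = green f w ↔ green g (φ z) = green g (φ w) := by
  constructor
  · intro h
    have := hφ.isSemiconj.green_eq_of_green_eq hf hg z.2 w.2 h
    rwa [extendZero_apply φ, extendZero_apply φ] at this
  · intro h
    have := hφ.symm.isSemiconj.green_eq_of_green_eq hg hf (φ z).2 (φ w).2 h
    rwa [extendZero_apply φ.symm, extendZero_apply φ.symm, φ.symm_apply_apply,
      φ.symm_apply_apply] at this

theorem IsConjugacy.green_lt_of_lt (hφ : IsConjugacy f g φ) (hf : 2 ≤ f.natDegree)
    (hg : 2 ≤ g.natDegree) {z w : basin f} (h : green f z < green f w) :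
    green g (φ z) < green g (φ w) := by
  have := hφ.isSemiconj.green_lt_of_green_lt hf hg ?_ z.2 w.2 h
  · rwa [extendZero_apply φ, extendZero_apply φ] at this
  · intro z hz w hw h
    rw [extendZero_of_mem φ hz, extendZero_of_mem φ hw] at h
    exact (hφ.green_eq_iff hf hg ⟨z, hz⟩ ⟨w, hw⟩).2 h

theorem IsConjugacy.green_lt_iff (hφ : IsConjugacy f g φ) (hf : 2 ≤ f.natDegree)
    (hg : 2 ≤ g.natDegree) (z w : basin f) :
    green f z < green f w ↔ green g (φ z) < green g (φ w) := by
  refine ⟨hφ.green_lt_of_lt hf hg, fun h => ?_⟩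
  have := hφ.symm.green_lt_of_lt hg hf h
  rwa [φ.symm_apply_apply, φ.symm_apply_apply] at this

end Conjugacy

/-! ### Rigidity on level curves and equality of degrees -/

/-- Continuous characters of `ℝ` are exponentials. -/
theorem exists_eq_exp_of_continuous_of_map_add {χ : ℝ → ℂ} (hc : Continuous χ) (h0 : χ 0 = 1)
    (hadd : ∀ x y, χ (x + y) = χ x * χ y) : ∃ a : ℂ, ∀ x : ℝ, χ x = Complex.exp (a * x) := by
  set I : ℝ → ℂ := fun x => ∫ t in (0 : ℝ)..x, χ t with hI
  have hId : ∀ x, HasDerivAt I (χ x) x := fun x =>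
    intervalIntegral.integral_hasDerivAt_right (hc.intervalIntegrable _ _)
      hc.aestronglyMeasurable.stronglyMeasurableAtFilter hc.continuousAt
  obtain ⟨δ, hδ⟩ : ∃ δ, I δ ≠ 0 := by
    by_contra! hcon
    have h1 := hId 0
    have h2 : I = fun _ => 0 := funext hcon
    rw [h2, h0] at h1
    exact one_ne_zero (h1.unique (hasDerivAt_const _ _))
  -- Integrating χ(x + t) = χ(x) χ(t) over t in [0, δ] expresses χ through its primitive, so
  -- continuity upgrades to differentiability.
  have hχ : ∀ x, χ x = (I (x + δ) - I x) / I δ := by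
    intro x
    rw [eq_div_iff hδ]
    have h1 : I (x + δ) - I x = ∫ t in x..(x + δ), χ t :=
      intervalIntegral.integral_interval_sub_left (hc.intervalIntegrable _ _)
        (hc.intervalIntegrable _ _)
    have h2 : ∫ t in (0 : ℝ)..δ, χ (x + t) = ∫ t in x..(x + δ), χ t := by
      simp
    rw [h1, ← h2]
    simp only [hadd, hI]
    rw [intervalIntegral.integral_const_mul]
  have hdiff : ∀ x, DifferentiableAt ℝ χ x := by
    intro x
    have : χ = fun x => (I (x + δ) - I x) / I δ := funext hχ
    rw [this]
    exact (((hId (x + δ)).comp_add_const x δ).sub (hId x)).differentiableAt.div_const _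
  set a := deriv χ 0 with ha
  have hder : ∀ x, HasDerivAt χ (χ x * a) x := by
    intro x
    have h1 : HasDerivAt (fun t => χ x * χ (t - x)) (χ x * a) x := by
      have h2 : HasDerivAt χ a (x - x) := by
        rw [sub_self]; exact (hdiff 0).hasDerivAt
      exact (h2.comp_sub_const x x).const_mul _
    refine h1.congr_of_eventuallyEq (Eventually.of_forall fun t => ?_)
    simp only [← hadd]
    congr 1
    ring
  refine ⟨a, fun x => ?_⟩
  have hE : ∀ x : ℝ, HasDerivAt (fun x : ℝ => Complex.exp (-(a * x)))
      (Complex.exp (-(a * x)) * -a) x := by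
    intro x
    have h1 : HasDerivAt (fun x : ℝ => -(a * (x : ℂ))) (-a) x := by
      convert! ((hasDerivAt_id x).ofReal_comp.const_mul a).neg using 1
      simp
    exact h1.cexp
  have hconst : ∀ x : ℝ, HasDerivAt (fun x : ℝ => χ x * Complex.exp (-(a * x))) 0 x := by
    intro x
    convert! (hder x).mul (hE x) using 1
    ring
  have h2 := is_const_of_deriv_eq_zero (fun x => (hconst x).differentiableAt)
    (fun x => (hconst x).deriv) x 0
  rw [h0, Complex.ofReal_zero, mul_zero, neg_zero, Complex.exp_zero, mul_one, Complex.exp_neg] at h2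
  exact (mul_inv_eq_one₀ (Complex.exp_ne_zero _)).1 h2

/-- A unitary character of `ℝ` with kernel `2πℤ` is `x ↦ exp (± i x)`. -/
theorem exists_eq_exp_I_of_ker {χ : ℝ → ℂ} (hc : Continuous χ)
    (hadd : ∀ x y, χ (x + y) = χ x * χ y) (hnorm : ∀ x, ‖χ x‖ = 1)
    (hper : χ (2 * Real.pi) = 1) (hker : ∀ x, χ x = 1 → ∃ k : ℤ, x = 2 * Real.pi * k) :
    ∃ τ : ℝ, (τ = 1 ∨ τ = -1) ∧ ∀ x : ℝ, χ x = Complex.exp (Complex.I * (τ * x : ℝ)) := by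
  have h0 : χ 0 = 1 := by
    have h1 := hadd 0 0
    have h2 : χ 0 ≠ 0 := norm_pos_iff.1 (by rw [hnorm]; exact one_pos)
    rw [add_zero] at h1
    exact (mul_left_cancel₀ h2 (by rw [mul_one]; exact h1)).symm
  obtain ⟨a, ha⟩ := exists_eq_exp_of_continuous_of_map_add hc h0 hadd
  have hre : a.re = 0 := by
    have := hnorm 1
    rw [ha, Complex.norm_exp] at this
    simpa using this
  have hχ : ∀ x : ℝ, χ x = Complex.exp (Complex.I * (a.im * x : ℝ)) := by
    intro x
    rw [ha]
    congr 1
    apply Complex.ext <;> simp [hre]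
  have hpi := Real.pi_pos
  have hexp1 : ∀ x : ℝ, Complex.exp (Complex.I * (x : ℝ)) = 1 → ∃ n : ℤ, x = n * (2 * Real.pi) := by
    intro x hx
    obtain ⟨n, hn⟩ := Complex.exp_eq_one_iff.1 hx
    refine ⟨n, ?_⟩
    have := congrArg Complex.im hn
    simpa using this
  -- The period 2π makes the frequency an integer m. The kernel then excludes m = 0 and, as it
  -- contains 2π/m, forces m to be a unit.
  obtain ⟨m, hm⟩ : ∃ m : ℤ, a.im = m := by
    rw [hχ] at hper
    obtain ⟨n, hn⟩ := hexp1 _ hper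
    exact ⟨n, mul_right_cancel₀ (by positivity : (2 * Real.pi) ≠ 0) hn⟩
  have hm0 : m ≠ 0 := by
    rintro rfl
    obtain ⟨k, hk⟩ := hker Real.pi (by rw [hχ, hm]; simp)
    have h2 : (2 * k : ℝ) = 1 := by
      have : Real.pi * (2 * k : ℝ) = Real.pi * 1 := by linarith
      exact mul_left_cancel₀ hpi.ne' this
    have h3 : 2 * k = 1 := by exact_mod_cast h2
    omega
  have hmR : (m : ℝ) ≠ 0 := by exact_mod_cast hm0
  obtain ⟨k, hk⟩ := hker (2 * Real.pi / m) (by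
    rw [hχ, hm, mul_div_cancel₀ _ hmR, Complex.exp_eq_one_iff]
    exact ⟨1, by push_cast; ring⟩)
  have hmk : m * k = 1 := by
    rw [div_eq_iff hmR] at hk
    have : (2 * Real.pi) * (m * k : ℝ) = (2 * Real.pi) * 1 := by linarith
    exact_mod_cast mul_left_cancel₀ (by positivity) this
  refine ⟨m, ?_, fun x => by rw [hχ, hm]⟩
  rcases Int.isUnit_iff.1 (IsUnit.of_mul_eq_one k hmk) with rfl | rfl
  · left; simp
  · right; simp

/-- A function on `ℝ` whose `N`-th power is constantly one is constant if it is continuous. -/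
theorem eq_of_continuous_of_pow_eq_one {ρ : ℝ → ℂ} (hc : Continuous ρ) {N : ℕ} (hN : 0 < N)
    (h : ∀ x, ρ x ^ N = 1) (x y : ℝ) : ρ x = ρ y := by
  have hfin : {z : ℂ | z ^ N = 1}.Finite := by
    have : NeZero N := ⟨hN.ne'⟩
    refine (Polynomial.nthRootsFinset N (1 : ℂ)).finite_toSet.subset fun z hz => ?_
    simpa [Polynomial.mem_nthRootsFinset hN] using hz
  exact isPreconnected_univ.constant_of_mapsTo (T := {z : ℂ | z ^ N = 1}) hfin.isDiscrete hc.continuousOn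
    (fun x _ => h x) (Set.mem_univ x) (Set.mem_univ y)

section Semiconj

variable {f g : Polynomial ℂ} {F : ℂ → ℂ}

/-- In Böttcher coordinates near infinity, an injective semiconjugacy acts on each level curve
as a rotation or a reflection. -/
theorem IsSemiconj.exists_param_vertical (hF : IsSemiconj f g F) (hinj : Set.InjOn F (basin f))
    (hf : 2 ≤ f.natDegree) (hg : 2 ≤ g.natDegree) (c : BottcherChart f) (c' : BottcherChart g)
    {s : ℂ} (hs : c.M < s.re) (hs' : c'.M < green g (F (c.param s))) :
    ∃ (s' : ℂ) (τ : ℝ), s'.re = green g (F (c.param s)) ∧ (τ = 1 ∨ τ = -1) ∧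
      ∀ y : ℝ, F (c.param (s + Complex.I * y)) = c'.param (s' + Complex.I * (τ * y : ℝ)) := by
  have hy : ∀ y : ℝ, c.M < (s + Complex.I * y).re := fun y => by simpa using hs
  have hgr : ∀ y : ℝ, c'.M < green g (F (c.param (s + Complex.I * y))) := fun y => by
    rwa [hF.green_vertical hf hg c hs]
  set β : ℝ → ℂ := fun y => c'.coord (F (c.param (s + Complex.I * y))) with hβ
  have hopen : IsOpen {z | c'.M < green g z} :=
    isOpen_Ioi.preimage (continuous_green g hg)
  have hβc : Continuous β := continuous_iff_continuousAt.2 fun y =>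
    ContinuousAt.comp (f := fun y : ℝ => F (c.param (s + Complex.I * y)))
      (c'.continuousOn_coord.continuousAt (hopen.mem_nhds (hgr y)))
      (hF.continuous_vertical hf c hs).continuousAt
  have hβ0 : ∀ y, β y ≠ 0 := fun y => c'.coord_ne_zero (hgr y)
  -- The two points have the same n-th iterate, so the quotient is a root of unity; being continuous
  -- in x, it cannot depend on x.
  have hshift : ∀ (j : ℤ) (n : ℕ) (x y : ℝ),
      β (x + 2 * Real.pi * j / (f.natDegree : ℝ) ^ n) / β x =
        β (y + 2 * Real.pi * j / (f.natDegree : ℝ) ^ n) / β y := by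
    intro j n
    refine eq_of_continuous_of_pow_eq_one (ρ := fun x =>
      β (x + 2 * Real.pi * j / (f.natDegree : ℝ) ^ n) / β x) (N := g.natDegree ^ n)
      ((hβc.comp (by fun_prop)).div hβc hβ0) (pow_pos (by omega) _) fun x => ?_
    simp only [hβ]
    rw [div_pow, ← c'.iterate_coord hg (hgr _), ← c'.iterate_coord hg (hgr _),
      hF.iterate_vertical hf c hs, div_self]
    rw [c'.iterate_coord hg (hgr _)]
    exact pow_ne_zero _ (hβ0 x)
  -- By density of the angles, β/β(0) is a character of ℝ. Injectivity of F and of `coord` will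
  -- identify its kernel as 2πℤ.
  have hmul : ∀ y r, β (y + r) * β 0 = β y * β r := by
    intro y r
    have h := Continuous.ext_on (f := fun r => β (y + r) * β 0) (g := fun r => β y * β r)
      (dense_two_pi_mul_div_pow hf) ((hβc.comp (by fun_prop)).mul continuous_const)
      (continuous_const.mul hβc) ?_
    · exact congrFun h r
    · rintro r ⟨j, n, rfl⟩
      have := hshift j n y 0
      rw [zero_add, div_eq_div_iff (hβ0 _) (hβ0 _)] at this
      simp only
      rw [this, mul_comm]
  have hβnorm : ∀ y, ‖β y‖ = ‖β 0‖ := by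
    intro y
    rw [c'.norm_coord _ (hgr y), c'.norm_coord _ (hgr 0), hF.green_vertical hf hg c hs y,
      hF.green_vertical hf hg c hs 0]
  have hstart : β 0 = c'.coord (F (c.param s)) := by simp [hβ]
  obtain ⟨τ, hτ, hχ⟩ := exists_eq_exp_I_of_ker (χ := fun y => β y / β 0) (hβc.div_const _)
    (fun x y => by
      have := hmul x y
      have h0 := hβ0 0
      field_simp
      exact this)
    (fun x => by rw [norm_div, hβnorm x, div_self (norm_ne_zero_iff.2 (hβ0 0))])
    (by
      have := c.param_add_two_pi s hs 1
      rw [Int.cast_one, mul_one] at this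
      simp only [hβ]
      rw [this, ← hstart, div_self (hβ0 0)])
    (fun x hx => by
      have h1 : β x = β 0 := by rwa [div_eq_one_iff_eq (hβ0 0)] at hx
      have h2 := c'.injOn_coord (hgr x) (hgr 0) h1
      have h3 := hinj (c.param_mem_basin hf (hy x)) (c.param_mem_basin hf (hy 0)) h2
      obtain ⟨n, hn⟩ := Complex.exp_eq_exp_iff_exists_int.1
        (c.exp_eq_of_param_eq (hy x) (hy 0) h3)
      refine ⟨-n, ?_⟩
      have := congrArg Complex.im hn
      simp at this
      push_cast
      linarith)
  obtain ⟨s', hs're, hs'p⟩ := c'.exists_param_eq hs'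
  have hM' : c'.M < s'.re := by rwa [hs're]
  -- The sign flips because `coord (param s)` is exp(-s).
  refine ⟨s', -τ, hs're, by rcases hτ with rfl | rfl <;> simp, fun y => ?_⟩
  have hM'' : c'.M < (s' + Complex.I * (-τ * y : ℝ)).re := by simpa using hM'
  refine c'.injOn_coord (hgr y) (c'.M_lt_green_param hM'') ?_
  have h1 := hχ y
  rw [div_eq_iff (hβ0 0), hstart, ← hs'p, c'.coord_param _ hM'] at h1
  rw [c'.coord_param _ hM'']
  change β y = _
  rw [h1, ← Complex.exp_add]
  congr 1
  push_cast
  ring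

/-- Iterating f multiplies the image potential by the degree of g each time. This yields a level
curve whose image lies in a prescribed chart of g. -/
theorem IsSemiconj.exists_large_param (hF : IsSemiconj f g F) (hf : 2 ≤ f.natDegree)
    (hg : 2 ≤ g.natDegree) (c : BottcherChart f) (M' : ℝ) :
    ∃ s : ℂ, c.M < s.re ∧ M' < green g (F (c.param s)) := by
  have h1 : c.M < ((c.M + 1 : ℝ) : ℂ).re := by rw [Complex.ofReal_re]; linarith
  have hb := c.param_mem_basin hf h1
  obtain ⟨n, hn, -⟩ := exists_lt_pow_mul (M := M') (two_le_cast_natDegree hg)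
    ((mem_basin_iff g hg _).1 (hF.mapsTo hb)) one_pos
  obtain ⟨h2, h3⟩ := c.iterate_param hf h1 n
  refine ⟨_, h3, ?_⟩
  rwa [← h2, hF.green_iterate_map hg hb]

/-- Points of a level curve at angle 2π/deg f have the same image under f. Their images under F are
at angle ±2π/deg f and must be identified by g, so deg g/deg f is an integer. -/
theorem IsSemiconj.natDegree_dvd (hF : IsSemiconj f g F) (hinj : Set.InjOn F (basin f))
    (hf : 2 ≤ f.natDegree) (hg : 2 ≤ g.natDegree) : f.natDegree ∣ g.natDegree := by
  obtain ⟨c⟩ := nonempty_bottcherChart f hf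
  obtain ⟨c'⟩ := nonempty_bottcherChart g hg
  obtain ⟨s, hs, hs'⟩ := hF.exists_large_param hf hg c c'.M
  obtain ⟨s', τ, hre, hτ, h⟩ := hF.exists_param_vertical hinj hf hg c c' hs hs'
  have hM' : c'.M < s'.re := by rwa [hre]
  have hy : ∀ y : ℝ, c.M < (s + Complex.I * y).re := fun y => by simpa using hs
  have hy' : ∀ y : ℝ, c'.M < (s' + Complex.I * (y : ℝ)).re := fun y => by simpa using hM'
  have key : ∀ y : ℝ, F (c.param (f.natDegree * (s + Complex.I * y))) =
      c'.param (g.natDegree * (s' + Complex.I * (τ * y : ℝ))) := by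
    intro y
    rw [← c.eval_param hf (hy y), hF.map_eval _ (c.param_mem_basin hf (hy y)), h,
      c'.eval_param hg (hy' _)]
  have hd : (f.natDegree : ℂ) ≠ 0 := by
    have : f.natDegree ≠ 0 := by omega
    exact_mod_cast this
  have hdR : (f.natDegree : ℝ) ≠ 0 := by exact_mod_cast hd
  have e1 : (f.natDegree : ℂ) * (s + Complex.I * (2 * Real.pi / f.natDegree : ℝ)) =
      f.natDegree * (s + Complex.I * (0 : ℝ)) + Complex.I * (2 * Real.pi * (1 : ℤ) : ℝ) := by
    push_cast
    field_simp
    ring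
  have h1 := key (2 * Real.pi / f.natDegree)
  rw [e1, c.param_add_two_pi _ (c.M_lt_natDegree_mul_re hf (hy 0)), key 0] at h1
  obtain ⟨n, hn⟩ := Complex.exp_eq_exp_iff_exists_int.1 (c'.exp_eq_of_param_eq
    (c'.M_lt_natDegree_mul_re hg (hy' _)) (c'.M_lt_natDegree_mul_re hg (hy' _)) h1)
  have h2 := congrArg Complex.im hn
  have h3 : (g.natDegree : ℝ) * τ = f.natDegree * n := by
    simp at h2
    field_simp at h2
    have hpi := Real.pi_pos.ne'
    have : (2 * Real.pi) * ((g.natDegree : ℝ) * τ) = (2 * Real.pi) * (f.natDegree * n) := by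
      linarith
    exact mul_left_cancel₀ (by positivity) this
  rcases hτ with rfl | rfl
  · rw [mul_one] at h3
    have h4 : (g.natDegree : ℤ) = f.natDegree * n := by exact_mod_cast h3
    exact Int.natCast_dvd_natCast.1 ⟨n, h4⟩
  · have h4 : (g.natDegree : ℤ) = f.natDegree * (-n) := by
      have : (g.natDegree : ℝ) = f.natDegree * (-n) := by linarith
      exact_mod_cast this
    exact Int.natCast_dvd_natCast.1 ⟨-n, h4⟩

end Semiconj

theorem IsConjugacy.natDegree_eq {f g : Polynomial ℂ} {φ : basin f ≃ₜ basin g}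
    (hφ : IsConjugacy f g φ) (hf : 2 ≤ f.natDegree) (hg : 2 ≤ g.natDegree) :
    f.natDegree = g.natDegree :=
  Nat.dvd_antisymm (hφ.isSemiconj.natDegree_dvd injOn_extendZero hf hg)
    (hφ.symm.isSemiconj.natDegree_dvd injOn_extendZero hg hf)

/-! ### Infinitesimal distortion -/

/-- With k = (K - 1)/(K + 1) and τ = 1, dropping q leaves |p - 1| ≤ k(p + 1), whose extreme
solutions are 1/K and K. For τ = -1 and p ≥ 0 the left side is at least the bracket on the right,
which k < 1 forbids: the map would reverse orientation. -/
theorem inv_le_and_le_of_sq_le {K p q τ : ℝ} (hK : 1 ≤ K) (hp : 0 ≤ p) (hτ : τ = 1 ∨ τ = -1)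
    (h : (p - τ) ^ 2 + q ^ 2 ≤ ((K - 1) / (K + 1)) ^ 2 * ((p + τ) ^ 2 + q ^ 2)) :
    1 / K ≤ p ∧ p ≤ K := by
  have hK1 : 0 < K + 1 := by linarith
  set k := (K - 1) / (K + 1) with hk
  have hkK : k * (K + 1) = K - 1 := div_mul_cancel₀ _ hK1.ne'
  have hk0 : 0 ≤ k := div_nonneg (by linarith) hK1.le
  have hk1 : k < 1 := by rw [hk, div_lt_one hK1]; linarith
  have hk2 : k ^ 2 < 1 := by nlinarith
  rcases hτ with rfl | rfl
  · have h1 : (p - 1) ^ 2 ≤ (k * (p + 1)) ^ 2 := by nlinarith [sq_nonneg q]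
    have h2 := abs_le.1 (abs_le_of_sq_le_sq h1 (by positivity))
    constructor
    · rw [div_le_iff₀ (by linarith)]
      nlinarith [h2.1]
    · nlinarith [h2.2]
  · exfalso
    have h1 : (p - 1) ^ 2 + q ^ 2 ≤ (p + 1) ^ 2 + q ^ 2 := by nlinarith
    have h2 : k ^ 2 * ((p - 1) ^ 2 + q ^ 2) ≤ k ^ 2 * ((p + 1) ^ 2 + q ^ 2) := by gcongr
    nlinarith [sq_nonneg q, sq_nonneg p]

/-- The distortion estimate for a real-linear map that, in the frames `b` and `a`, sends the
vertical direction to itself isometrically. -/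
theorem distortion_of_vertical_isometry {D : ℂ →L[ℝ] ℂ} {a b : ℂ} {K τ : ℝ} (ha : a ≠ 0)
    (hb : b ≠ 0) (hK : 1 ≤ K) (hτ : τ = 1 ∨ τ = -1)
    (hI : D (b * Complex.I) = a * (Complex.I * τ)) (hp : 0 ≤ (D b / a).re)
    (hD : ‖(D 1 + Complex.I * D Complex.I) / 2‖ ≤
      (K - 1) / (K + 1) * ‖(D 1 - Complex.I * D Complex.I) / 2‖) :
    1 / K ≤ (D b / a).re ∧ (D b / a).re ≤ K := by
  set A := (D 1 - Complex.I * D Complex.I) / 2 with hA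
  set B := (D 1 + Complex.I * D Complex.I) / 2 with hB
  have hlin : ∀ η : ℂ, D η = A * η + B * (starRingEnd ℂ) η := by
    intro η
    have h1 : η = η.re • (1 : ℂ) + η.im • Complex.I := by
      simp [Complex.re_add_im]
    conv_lhs => rw [h1]
    rw [map_add, map_smul, map_smul]
    have h2 : (starRingEnd ℂ) η = η.re - η.im * Complex.I := by
      apply Complex.ext <;> simp
    have h3 : η = η.re + η.im * Complex.I := (Complex.re_add_im η).symm
    rw [h2]
    simp only [hA, hB, Complex.real_smul]
    linear_combination -((D 1 - Complex.I * D Complex.I) / 2) * h3 +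
      (D Complex.I * (η.im : ℂ)) * Complex.I_sq
  -- X and Y are the complex-linear and antilinear coefficients of D read in the frames b and a.
  -- Evaluating at i gives X - Y = τ, and evaluating at 1 gives X + Y = D b / a.
  set X := A * b / a with hX
  set Y := B * (starRingEnd ℂ) b / a with hY
  have hsub : X - Y = τ := by
    rw [hlin, map_mul, Complex.conj_I] at hI
    have : (A * b - B * (starRingEnd ℂ) b) * Complex.I = a * τ * Complex.I := by
      linear_combination hI
    have := mul_right_cancel₀ Complex.I_ne_zero this
    simp only [hX, hY]
    rw [← sub_div, this]
    field_simp
  have hadd : X + Y = D b / a := by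
    rw [hlin, hX, hY, add_div]
  set p := (D b / a).re with hpdef
  set q := (D b / a).im with hqdef
  have hXY : ‖Y‖ ≤ (K - 1) / (K + 1) * ‖X‖ := by
    simp only [hX, hY, norm_div, norm_mul, RCLike.norm_conj]
    rw [← mul_div_assoc, ← mul_assoc]
    gcongr
  have e1 : ‖X‖ ^ 2 = ((p + τ) ^ 2 + q ^ 2) / 4 := by
    have h1 : X = (D b / a + τ) / 2 := by rw [← hadd, ← hsub]; ring
    rw [h1, norm_div, div_pow, ← Complex.normSq_eq_norm_sq, Complex.normSq_apply]
    simp [← hpdef, ← hqdef]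
    ring
  have e2 : ‖Y‖ ^ 2 = ((p - τ) ^ 2 + q ^ 2) / 4 := by
    have h1 : Y = (D b / a - τ) / 2 := by rw [← hadd, ← hsub]; ring
    rw [h1, norm_div, div_pow, ← Complex.normSq_eq_norm_sq, Complex.normSq_apply]
    simp [← hpdef, ← hqdef]
    ring
  refine inv_le_and_le_of_sq_le hK hp hτ (q := q) ?_
  have h1 : ‖Y‖ ^ 2 ≤ ((K - 1) / (K + 1) * ‖X‖) ^ 2 := by gcongr
  rw [mul_pow, e1, e2] at h1
  linarith

/-- The component of η along the level curve stays along the level curve, so it does not contribute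
to the real part. Since Re(·/b) and Re(·/a) will be the differentials of the Green functions, D
rescales one into the other. -/
theorem re_map_div_of_vertical {D : ℂ →L[ℝ] ℂ} {a b : ℂ} {τ : ℝ} (ha : a ≠ 0) (hb : b ≠ 0)
    (hI : D (b * Complex.I) = a * (Complex.I * τ)) (η : ℂ) :
    (D η / a).re = (D b / a).re * (η / b).re := by
  have h1 : η = (η / b).re • b + (η / b).im • (b * Complex.I) := by
    have := Complex.re_add_im (η / b)
    simp only [Complex.real_smul]
    calc η = (η / b) * b := (div_mul_cancel₀ _ hb).symm
      _ = (((η / b).re : ℂ) + ((η / b).im : ℂ) * Complex.I) * b := by rw [this]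
      _ = _ := by ring
  conv_lhs => rw [h1]
  rw [map_add, map_smul, map_smul, hI, add_div, Complex.add_re, smul_div_assoc, smul_div_assoc,
    mul_div_cancel_left₀ _ ha]
  simp
  ring

theorem hasDerivAt_comp_line {P : ℂ → ℂ} {s b : ℂ} (h : HasDerivAt P b s) (v : ℂ) :
    HasDerivAt (fun t : ℝ => P (s + v * t)) (b * v) 0 := by
  have h1 : HasDerivAt (fun w : ℂ => s + v * w) v ((0 : ℝ) : ℂ) := by
    simpa using ((hasDerivAt_id ((0 : ℝ) : ℂ)).const_mul v).const_add s
  have h2 : HasDerivAt P b (s + v * ((0 : ℝ) : ℂ)) := by simpa using h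
  exact (HasDerivAt.comp ((0 : ℝ) : ℂ) h2 h1).comp_ofReal

namespace BottcherChart

variable {f : Polynomial ℂ} (c : BottcherChart f)

theorem hasFDerivAt_green {z : ℂ} (hz : c.M < green f z) :
    HasFDerivAt (green f) (fderiv ℝ (green f) z) z :=
  ((c.contDiffAt_green z hz).differentiableAt one_ne_zero).hasFDerivAt

/-- Differentiation of G(param s) = Re s. It shows that `param` has no critical point and identifies
dG with Re(·/param'). -/
theorem fderiv_green_param {s : ℂ} (hs : c.M < s.re) (v : ℂ) :
    fderiv ℝ (green f) (c.param s) (deriv c.param s * v) = v.re := by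
  have h1 := hasDerivAt_comp_line (c.differentiableAt_param s hs).hasDerivAt v
  have h2 := (c.hasFDerivAt_green (c.M_lt_green_param hs)).comp_hasDerivAt_of_eq (0 : ℝ) h1
    (by simp)
  have h3 : HasDerivAt (fun t : ℝ => (s + v * t).re) v.re 0 := by
    have : HasDerivAt (fun t : ℝ => s.re + v.re * t) v.re 0 := by
      simpa using ((hasDerivAt_id (0 : ℝ)).const_mul v.re).const_add s.re
    simpa using this
  have hev : ∀ᶠ t : ℝ in 𝓝 0, c.M < (s + v * t).re := by
    have : ContinuousAt (fun t : ℝ => (s + v * t).re) 0 := by fun_prop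
    exact this.eventually_const_lt (by simpa using hs)
  refine h2.unique (h3.congr_of_eventuallyEq ?_)
  filter_upwards [hev] with t ht
  exact c.green_param _ ht

theorem deriv_param_ne_zero {s : ℂ} (hs : c.M < s.re) : deriv c.param s ≠ 0 := by
  intro h
  have := c.fderiv_green_param hs 1
  rw [h] at this
  simp at this

theorem fderiv_green_apply {s : ℂ} (hs : c.M < s.re) (η : ℂ) :
    fderiv ℝ (green f) (c.param s) η = (η / deriv c.param s).re := by
  rw [← c.fderiv_green_param hs, mul_div_cancel₀ _ (c.deriv_param_ne_zero hs)]

end BottcherChart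

/-- Infinitesimally, at a point of differentiability satisfying the Beltrami inequality, a
conjugacy multiplies the differential of the Green function by a factor in `[1 / K, K]`. -/
theorem IsConjugacy.exists_fderiv_green_eq {f g : Polynomial ℂ} {φ : basin f ≃ₜ basin g}
    (hφ : IsConjugacy f g φ) (hf : 2 ≤ f.natDegree) (hg : 2 ≤ g.natDegree)
    (c : BottcherChart f) (c' : BottcherChart g) {z : ℂ} {K : ℝ} (hK : 1 ≤ K)
    (hz : c.M < green f z) (hz' : c'.M < green g (extendZero φ z))
    (hd : DifferentiableAt ℝ (extendZero φ) z)
    (hB : ‖wirtingerBar (extendZero φ) z‖ ≤ (K - 1) / (K + 1) * ‖wirtinger (extendZero φ) z‖) :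
    ∃ p : ℝ, 1 / K ≤ p ∧ p ≤ K ∧ ∀ η : ℂ,
      fderiv ℝ (green g) (extendZero φ z) (fderiv ℝ (extendZero φ) z η) =
        p * fderiv ℝ (green f) z η := by
  obtain ⟨s, hs, rfl⟩ := c.exists_param_eq hz
  rw [← hs] at hz
  obtain ⟨s', τ, hs're, hτ, hvert⟩ :=
    hφ.isSemiconj.exists_param_vertical injOn_extendZero hf hg c c' hz hz'
  have hM' : c'.M < s'.re := by rwa [hs're]
  set F := extendZero φ with hF
  set D := fderiv ℝ F (c.param s) with hD
  set b := deriv c.param s with hb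
  set a := deriv c'.param s' with ha
  have hs'F : c'.param s' = F (c.param s) := by simpa using (hvert 0).symm
  have hb0 : b ≠ 0 := c.deriv_param_ne_zero hz
  have ha0 : a ≠ 0 := c'.deriv_param_ne_zero hM'
  have hline : ∀ v : ℂ, HasDerivAt (fun t : ℝ => F (c.param (s + v * t))) (D (b * v)) 0 :=
    fun v => hd.hasFDerivAt.comp_hasDerivAt_of_eq (0 : ℝ)
      (hasDerivAt_comp_line (c.differentiableAt_param s hz).hasDerivAt v) (by simp)
  -- This is the infinitesimal form of the rotation or reflection on the level curve.
  have hI : D (b * Complex.I) = a * (Complex.I * τ) := by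
    refine (hline Complex.I).unique ?_
    refine (hasDerivAt_comp_line (c'.differentiableAt_param s' hM').hasDerivAt
      (Complex.I * τ)).congr_of_eventuallyEq (Eventually.of_forall fun t => ?_)
    simp only [hvert]
    congr 1
    push_cast
    ring
  have hdG : ∀ η, fderiv ℝ (green g) (F (c.param s)) η = (η / a).re := by
    intro η
    rw [← hs'F, c'.fderiv_green_apply hM']
  -- The order of potentials is preserved, so the image potential is nondecreasing along the
  -- horizontal line through s.
  have hp : 0 ≤ (D b / a).re := by
    have h1 := (c'.hasFDerivAt_green hz').comp_hasDerivAt_of_eq (0 : ℝ) (hline 1) (by simp)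
    rw [mul_one, hdG] at h1
    have hopen : IsOpen {t : ℝ | c.M < (s + 1 * (t : ℂ)).re} :=
      isOpen_lt continuous_const (by fun_prop)
    have h0 : (0 : ℝ) ∈ {t : ℝ | c.M < (s + 1 * (t : ℂ)).re} := by simpa using hz
    refine h1.hasDerivWithinAt.nonneg_of_monotoneOn (s := {t : ℝ | c.M < (s + 1 * (t : ℂ)).re})
      (accPt_iff_nhds.2 ?_) ?_
    · intro U hU
      obtain ⟨ε, hε, hball⟩ := Metric.mem_nhds_iff.1 (inter_mem hU (hopen.mem_nhds h0))
      have hmem : ε / 2 ∈ Metric.ball (0 : ℝ) ε := by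
        rw [mem_ball_zero_iff, Real.norm_eq_abs, abs_of_pos (by positivity)]
        linarith
      exact ⟨ε / 2, hball hmem, by positivity⟩
    · intro t ht u hu htu
      have hbt := c.param_mem_basin hf ht
      have hbu := c.param_mem_basin hf hu
      have hle : green f (c.param (s + 1 * (t : ℂ))) ≤ green f (c.param (s + 1 * (u : ℂ))) := by
        rw [c.green_param _ ht, c.green_param _ hu]
        simpa using htu
      have := (hφ.green_lt_iff hf hg ⟨_, hbu⟩ ⟨_, hbt⟩).not.1 (not_lt.2 hle)
      simp only [Function.comp_apply, hF]
      rw [extendZero_of_mem φ hbt, extendZero_of_mem φ hbu]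
      exact not_lt.1 this
  obtain ⟨h1, h2⟩ := distortion_of_vertical_isometry ha0 hb0 hK hτ hI hp hB
  refine ⟨_, h1, h2, fun η => ?_⟩
  rw [hdG, c.fderiv_green_apply hz, re_map_div_of_vertical ha0 hb0 hI]

/-! ### From infinitesimal distortion to differences of potentials -/

theorem _root_.AbsolutelyContinuousOnInterval.lipschitzOnWith_comp {X Y : Type*}
    [PseudoMetricSpace X] [PseudoMetricSpace Y] {F : ℝ → X} {G : X → Y} {a b : ℝ} {C : NNReal}
    (hF : AbsolutelyContinuousOnInterval F a b)
    (hG : LipschitzOnWith C G (F '' Set.uIcc a b)) :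
    AbsolutelyContinuousOnInterval (fun x => G (F x)) a b := by
  rw [absolutelyContinuousOnInterval_iff] at hF ⊢
  intro ε hε
  obtain ⟨δ, hδ, h⟩ := hF (ε / (C + 1)) (by positivity)
  refine ⟨δ, hδ, fun E hE hlen => ?_⟩
  calc _ ≤ ∑ i ∈ Finset.range E.1, C * dist (F (E.2 i).1) (F (E.2 i).2) :=
        Finset.sum_le_sum fun i hi => hG.dist_le_mul _ (Set.mem_image_of_mem F (hE.1 i hi).1) _
          (Set.mem_image_of_mem F (hE.1 i hi).2)
    _ = C * ∑ i ∈ Finset.range E.1, dist (F (E.2 i).1) (F (E.2 i).2) := (Finset.mul_sum ..).symm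
    _ ≤ (C + 1) * ∑ i ∈ Finset.range E.1, dist (F (E.2 i).1) (F (E.2 i).2) := by
        have : 0 ≤ ∑ i ∈ Finset.range E.1, dist (F (E.2 i).1) (F (E.2 i).2) :=
          Finset.sum_nonneg fun _ _ => dist_nonneg
        nlinarith
    _ < (C + 1) * (ε / (C + 1)) := by gcongr; exact h E hE hlen
    _ = ε := by field_simp

/-- Fubini for null sets: on almost every horizontal line almost every point has a given
almost sure property. -/
theorem ae_horizontal_of_ae {p : ℂ → Prop} (h : ∀ᵐ z : ℂ, p z) :
    ∀ᵐ y : ℝ, ∀ᵐ x : ℝ, p (⟨x, y⟩ : ℂ) := by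
  have h1 : ∀ᵐ q : ℝ × ℝ, p (⟨q.1, q.2⟩ : ℂ) :=
    (Complex.volume_preserving_equiv_real_prod.symm).quasiMeasurePreserving.ae h
  have h2 : ∀ᵐ q : ℝ × ℝ ∂((volume : Measure ℝ).prod volume), p (⟨q.2, q.1⟩ : ℂ) :=
    (Measure.measurePreserving_swap (μ := (volume : Measure ℝ))
      (ν := (volume : Measure ℝ))).quasiMeasurePreserving.ae h1
  exact Measure.ae_ae_of_ae_prod h2

theorem exists_green_gt_of_re_ge (f : Polynomial ℂ) (hf : 2 ≤ f.natDegree) (M : ℝ) :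
    ∃ a : ℝ, ∀ z : ℂ, a ≤ z.re → M < green f z := by
  obtain ⟨C, hC⟩ := exists_abs_green_sub_posLog_le f hf
  refine ⟨Real.exp (M + C + 1), fun z hz => ?_⟩
  have h1 : M + C + 1 ≤ Real.log ‖z‖ := by
    have h2 : Real.exp (M + C + 1) ≤ ‖z‖ :=
      hz.trans ((le_abs_self _).trans (Complex.abs_re_le_norm z))
    rwa [Real.le_log_iff_exp_le ((Real.exp_pos _).trans_le h2)]
  have h2 : Real.log ‖z‖ ≤ Real.posLog ‖z‖ := le_max_right _ _
  linarith [(abs_le.1 (hC z)).1]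

theorem hasDerivAt_horizontal {G : ℂ → ℝ} {x y : ℝ} (h : DifferentiableAt ℝ G (⟨x, y⟩ : ℂ)) :
    HasDerivAt (fun t : ℝ => G (⟨t, y⟩ : ℂ)) (fderiv ℝ G (⟨x, y⟩ : ℂ) 1) x := by
  have h1 : HasDerivAt (fun t : ℝ => (⟨t, y⟩ : ℂ)) 1 x := by
    have h2 : HasDerivAt (fun t : ℝ => (t : ℂ) + y * Complex.I) 1 x :=
      Complex.ofRealCLM.hasDerivAt.add_const _
    refine h2.congr_of_eventuallyEq (Eventually.of_forall fun t => ?_)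
    apply Complex.ext <;> simp
  exact h.hasFDerivAt.comp_hasDerivAt x h1

/-- If two absolutely continuous functions have comparable derivatives almost everywhere, then
their increments are comparable. -/
theorem sub_le_mul_sub_of_ae_deriv_le {u v : ℝ → ℝ} {a b K : ℝ} (hab : a ≤ b)
    (hu : AbsolutelyContinuousOnInterval u a b) (hv : AbsolutelyContinuousOnInterval v a b)
    (h : ∀ᵐ x, x ∈ Set.Icc a b → deriv u x ≤ K * deriv v x) :
    u b - u a ≤ K * (v b - v a) := by
  rw [← hu.integral_deriv_eq_sub, ← hv.integral_deriv_eq_sub,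
    ← intervalIntegral.integral_const_mul]
  exact intervalIntegral.integral_mono_ae_restrict hab hu.intervalIntegrable_deriv
    (hv.intervalIntegrable_deriv.const_mul K) ((ae_restrict_iff' measurableSet_Icc).2 h)

section Quasiconformal

variable {f g : Polynomial ℂ} {φ : basin f ≃ₜ basin g}

/-- The potential estimate near infinity. -/
theorem IsConjugacy.exists_green_sub_le (hφ : IsConjugacy f g φ) (hf : 2 ≤ f.natDegree)
    (hg : 2 ≤ g.natDegree) {K : ℝ} (hqc : IsQuasiconformal φ K) :
    ∃ M : ℝ, ∀ z₁ z₂ : basin f, M < green f z₁ → green f z₁ ≤ green f z₂ →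
      green f z₂ - green f z₁ ≤ K * (green g (φ z₂) - green g (φ z₁)) ∧
      green g (φ z₂) - green g (φ z₁) ≤ K * (green f z₂ - green f z₁) := by
  obtain ⟨hK, hacl, hdiff, hbel⟩ := hqc
  have hK0 : 0 < K := by linarith
  obtain ⟨c⟩ := nonempty_bottcherChart f hf
  obtain ⟨c'⟩ := nonempty_bottcherChart g hg
  obtain ⟨s, hs, hs'⟩ := hφ.isSemiconj.exists_large_param hf hg c c'.M
  obtain ⟨R, hR⟩ := exists_fderiv_green_one_nonneg f hf
  obtain ⟨a₀, ha₀⟩ := exists_green_gt_of_re_ge f hf s.re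
  set F := extendZero φ with hF
  -- To the right of Re z = a the source and image points lie in the charts and the Green function
  -- of f has nonnegative horizontal derivative.
  set a := max R a₀ with ha
  have hbasin : ∀ z : ℂ, a ≤ z.re → z ∈ basin f := fun z hz => by
    rw [mem_basin_iff f hf]
    exact (c.M_pos.trans hs).trans (ha₀ z ((le_max_right _ _).trans hz))
  have hcM : ∀ z : ℂ, a ≤ z.re → c.M < green f z := fun z hz =>
    hs.trans (ha₀ z ((le_max_right _ _).trans hz))
  have hc'M : ∀ z : ℂ, a ≤ z.re → c'.M < green g (F z) := fun z hz => by
    have h1 := hφ.green_lt_of_lt hf hg (z := ⟨_, c.param_mem_basin hf hs⟩)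
      (w := ⟨z, hbasin z hz⟩) (by
        change green f (c.param s) < green f z
        rw [c.green_param s hs]
        exact ha₀ z ((le_max_right _ _).trans hz))
    rw [← extendZero_of_mem φ, ← extendZero_of_mem φ] at h1
    exact hs'.trans h1
  have hcurve : ∀ y : ℝ, Continuous fun x : ℝ => (⟨x, y⟩ : ℂ) := fun y => by
    have : (fun x : ℝ => (⟨x, y⟩ : ℂ)) = fun x : ℝ => (x : ℂ) + y * Complex.I := by
      ext x; apply Complex.ext <;> simp
    rw [this]
    fun_prop
  -- M bounds the potential on the left edge of the strip |Im z| ≤ 1, so every horizontal line of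
  -- the strip starts below the potential of z₁.
  obtain ⟨M, hM⟩ : ∃ M : ℝ, ∀ y ∈ Set.Icc (-1 : ℝ) 1, green f (⟨a, y⟩ : ℂ) ≤ M := by
    have hc : Continuous fun y : ℝ => green f (⟨a, y⟩ : ℂ) := by
      have : (fun y : ℝ => green f (⟨a, y⟩ : ℂ)) =
          fun y : ℝ => green f ((a : ℂ) + y * Complex.I) := by
        ext x; congr 1; apply Complex.ext <;> simp
      rw [this]
      exact (continuous_green f hf).comp (by fun_prop)
    obtain ⟨M, hM⟩ := (isCompact_Icc (a := (-1 : ℝ)) (b := 1)).bddAbove_image hc.continuousOn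
    exact ⟨M, fun y hy => hM ⟨y, hy, rfl⟩⟩
  refine ⟨M, fun z₁ z₂ h₁ h₁₂ => ?_⟩
  obtain ⟨b₀, hb₀⟩ := exists_green_gt_of_re_ge f hf (green f z₂)
  set b := max a b₀ with hb
  have hab : a ≤ b := le_max_left _ _
  have hrect : Set.Icc a b ×ℂ Set.Icc (-1 : ℝ) 1 ⊆ basin f := fun z hz => hbasin z hz.1.1
  have hlines := (hacl a b (-1) 1 hab (by norm_num) hrect).1
  have hae : ∀ᵐ z : ℂ, z ∈ basin f → DifferentiableAt ℝ F z ∧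
      ‖wirtingerBar F z‖ ≤ (K - 1) / (K + 1) * ‖wirtinger F z‖ :=
    (ae_restrict_iff' (isOpen_basin f hf).measurableSet).1 (hdiff.and hbel)
  -- The interval [-1, 1] has positive measure, so the almost-everywhere conditions hold on at least
  -- one horizontal line.
  have hne : (ae ((volume : Measure ℝ).restrict (Set.Icc (-1 : ℝ) 1))).NeBot := by
    rw [ae_neBot, Ne, Measure.restrict_eq_zero]
    simp
  obtain ⟨y, ⟨hyac, hyae⟩, hyI⟩ := ((hlines.and
    (ae_restrict_of_ae (ae_horizontal_of_ae hae))).and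
      (ae_restrict_mem measurableSet_Icc)).exists
  set v : ℝ → ℝ := fun x => green f (⟨x, y⟩ : ℂ) with hv
  set u : ℝ → ℝ := fun x => green g (F (⟨x, y⟩ : ℂ)) with hu
  have hvc : Continuous v := (continuous_green f hf).comp (hcurve y)
  have hva : v a ≤ green f z₁ := (hM y hyI).trans h₁.le
  have hvb : green f z₂ ≤ v b := (hb₀ _ (le_max_right a b₀)).le
  -- The image potential depends only on the source potential, so z₁ and z₂ may be replaced by
  -- points of the chosen line with the same potentials.
  obtain ⟨x₁, hx₁, hvx₁⟩ := intermediate_value_Icc hab hvc.continuousOn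
    (show green f z₁ ∈ Set.Icc (v a) (v b) from ⟨hva, h₁₂.trans hvb⟩)
  obtain ⟨x₂, hx₂, hvx₂⟩ := intermediate_value_Icc hx₁.2 hvc.continuousOn
    (show green f z₂ ∈ Set.Icc (v x₁) (v b) from ⟨by rwa [hvx₁], hvb⟩)
  have hsub : Set.Icc x₁ x₂ ⊆ Set.Icc a b := Set.Icc_subset_Icc hx₁.1 hx₂.2
  have huz : ∀ z : basin f, ∀ x ∈ Set.Icc a b, v x = green f z → u x = green g (φ z) := by
    intro z x hx hxz
    have hb := hbasin (⟨x, y⟩ : ℂ) hx.1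
    have := (hφ.green_eq_iff hf hg ⟨_, hb⟩ z).1 hxz
    simp only [hu, hF]
    rw [extendZero_of_mem φ hb, this]
  have hvac : AbsolutelyContinuousOnInterval v x₁ x₂ := by
    refine ContDiffOn.absolutelyContinuousOnInterval fun x hx => ?_
    rw [Set.uIcc_of_le hx₂.1] at hx
    have hcd : ContDiff ℝ 1 fun x : ℝ => (⟨x, y⟩ : ℂ) := by
      have : (fun x : ℝ => (⟨x, y⟩ : ℂ)) = fun x : ℝ => (x : ℂ) + y * Complex.I := by
        ext x; apply Complex.ext <;> simp
      rw [this]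
      exact Complex.ofRealCLM.contDiff.add contDiff_const
    exact ((c.contDiffAt_green _ (hcM (⟨x, y⟩ : ℂ) (hsub hx).1)).comp x
      hcd.contDiffAt).contDiffWithinAt
  have hFac : AbsolutelyContinuousOnInterval (fun x : ℝ => F (⟨x, y⟩ : ℂ)) x₁ x₂ :=
    hyac.mono (by rw [Set.uIcc_of_le hx₂.1, Set.uIcc_of_le hab]; exact hsub)
  -- The Green function of g is C¹ in the chart, hence Lipschitz on the compact image of the
  -- segment, and composition preserves absolute continuity.
  have huac : AbsolutelyContinuousOnInterval u x₁ x₂ := by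
    have hcomp : IsCompact ((fun x : ℝ => F (⟨x, y⟩ : ℂ)) '' Set.uIcc x₁ x₂) :=
      isCompact_uIcc.image_of_continuousOn hFac.continuousOn
    have hloc : LocallyLipschitzOn ((fun x : ℝ => F (⟨x, y⟩ : ℂ)) '' Set.uIcc x₁ x₂)
        (green g) := by
      rintro _ ⟨x, hx, rfl⟩
      rw [Set.uIcc_of_le hx₂.1] at hx
      obtain ⟨C, t, ht, hC⟩ := (c'.contDiffAt_green _
        (hc'M (⟨x, y⟩ : ℂ) (hsub hx).1)).hasStrictFDerivAt one_ne_zero |>.exists_lipschitzOnWith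
      exact ⟨C, t, mem_nhdsWithin_of_mem_nhds ht, hC⟩
    obtain ⟨C, hC⟩ := hloc.exists_lipschitzOnWith_of_compact hcomp
    exact hFac.lipschitzOnWith_comp hC
  have hderiv : ∀ᵐ x : ℝ, x ∈ Set.Icc x₁ x₂ →
      deriv v x ≤ K * deriv u x ∧ deriv u x ≤ K * deriv v x := by
    filter_upwards [hyae] with x hx hxI
    have hxa : a ≤ (⟨x, y⟩ : ℂ).re := (hsub hxI).1
    obtain ⟨hd, hB⟩ := hx (hbasin _ hxa)
    obtain ⟨p, hp1, hp2, hp⟩ := hφ.exists_fderiv_green_eq hf hg c c' hK (hcM _ hxa)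
      (hc'M _ hxa) hd hB
    have hgd := c'.hasFDerivAt_green (hc'M _ hxa)
    have hdv := (hasDerivAt_horizontal (c.hasFDerivAt_green (hcM _ hxa)).differentiableAt).deriv
    have hcompd := hgd.comp (⟨x, y⟩ : ℂ) hd.hasFDerivAt
    have hdu := (hasDerivAt_horizontal hcompd.differentiableAt).deriv
    rw [hcompd.fderiv, ContinuousLinearMap.comp_apply, hp, ← hdv] at hdu
    have hv0 : 0 ≤ deriv v x := by
      rw [hdv]
      exact hR _ ((le_max_left _ _).trans hxa)
    -- Since v' ≥ 0, the bounds 1/K ≤ p ≤ K give inequalities between u' and v' in both directions.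
    have hdu' : deriv u x = p * deriv v x := hdu
    rw [hdu']
    rw [div_le_iff₀ hK0] at hp1
    constructor <;> nlinarith
  have e1 := sub_le_mul_sub_of_ae_deriv_le hx₂.1 hvac huac (hderiv.mono fun x h hx => (h hx).1)
  have e2 := sub_le_mul_sub_of_ae_deriv_le hx₂.1 huac hvac (hderiv.mono fun x h hx => (h hx).2)
  rw [huz z₁ x₁ hx₁ hvx₁, huz z₂ x₂ (hsub ⟨hx₂.1, le_rfl⟩) hvx₂, hvx₁, hvx₂] at e1 e2
  exact ⟨e1, e2⟩

theorem coe_iterate_basinMap (f : Polynomial ℂ) (n : ℕ) (z : basin f) :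
    (((basinMap f)^[n] z : basin f) : ℂ) = (fun w => f.eval w)^[n] z := by
  induction n with
  | zero => rfl
  | succ n ih => rw [Function.iterate_succ_apply', Function.iterate_succ_apply', ← ih]; rfl

theorem IsConjugacy.map_iterate (hφ : IsConjugacy f g φ) (n : ℕ) (z : basin f) :
    φ ((basinMap f)^[n] z) = (basinMap g)^[n] (φ z) :=
  Function.Semiconj.iterate_right (f := φ) hφ n z

/-- A `K`-quasiconformal conjugacy distorts differences of potentials by at most `K`. -/
theorem IsConjugacy.green_sub_le (hφ : IsConjugacy f g φ) (hf : 2 ≤ f.natDegree)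
    (hg : 2 ≤ g.natDegree) {K : ℝ} (hqc : IsQuasiconformal φ K) {z₁ z₂ : basin f}
    (h : green f z₁ ≤ green f z₂) :
    green f z₂ - green f z₁ ≤ K * (green g (φ z₂) - green g (φ z₁)) ∧
      green g (φ z₂) - green g (φ z₁) ≤ K * (green f z₂ - green f z₁) := by
  obtain ⟨M, hM⟩ := hφ.exists_green_sub_le hf hg hqc
  have hd := two_le_cast_natDegree hf
  -- Iterating both points enters the region of the estimate at infinity. The degrees being equal,
  -- every difference acquires the same factor d^n, which cancels.
  obtain ⟨n, hn, -⟩ := exists_lt_pow_mul (M := M) hd (green_pos hf z₁) one_pos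
  have hpos : (0 : ℝ) < (f.natDegree : ℝ) ^ n := by positivity
  have := hM ((basinMap f)^[n] z₁) ((basinMap f)^[n] z₂)
  rw [hφ.map_iterate, hφ.map_iterate] at this
  simp only [coe_iterate_basinMap, green_iterate f hf, green_iterate g hg,
    ← hφ.natDegree_eq hf hg] at this
  obtain ⟨h1, h2⟩ := this hn (by gcongr)
  constructor
  · refine le_of_mul_le_mul_left ?_ hpos
    linarith
  · refine le_of_mul_le_mul_left ?_ hpos
    linarith

end Quasiconformal

/-! ### The induced homeomorphism of trees -/

section Tree

variable {f g : Polynomial ℂ} {φ : basin f ≃ₜ basin g}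

theorem treeProj_surjective (f : Polynomial ℂ) : Function.Surjective (treeProj f) :=
  Quotient.mk_surjective

theorem continuous_treeProj (f : Polynomial ℂ) : Continuous (treeProj f) :=
  continuous_quotient_mk'

/-- The image of a component is connected and lies in a single level set, hence in a single
component. -/
theorem IsConjugacy.treeSetoid_map (hφ : IsConjugacy f g φ) (hf : 2 ≤ f.natDegree)
    (hg : 2 ≤ g.natDegree) {z w : basin f} (h : treeSetoid f z w) :
    treeSetoid g (φ z) (φ w) := by
  have hpre : IsPreconnected (φ '' connectedComponentIn (levelSet f z) z) :=
    isPreconnected_connectedComponentIn.image _ φ.continuous.continuousOn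
  refine hpre.subset_connectedComponentIn
    ⟨z, mem_connectedComponentIn (self_mem_levelSet f z), rfl⟩ ?_ ⟨w, h, rfl⟩
  rintro _ ⟨x, hx, rfl⟩
  exact (hφ.green_eq_iff hf hg x z).1 (mem_levelSet.1 (connectedComponentIn_subset _ _ hx))

/-- The map of trees induced by a conjugacy. -/
noncomputable def IsConjugacy.mapTree (hφ : IsConjugacy f g φ) (hf : 2 ≤ f.natDegree)
    (hg : 2 ≤ g.natDegree) : Tree f → Tree g :=
  Quotient.map φ fun _ _ h => hφ.treeSetoid_map hf hg h

theorem IsConjugacy.mapTree_treeProj (hφ : IsConjugacy f g φ) (hf : 2 ≤ f.natDegree)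
    (hg : 2 ≤ g.natDegree) (z : basin f) :
    hφ.mapTree hf hg (treeProj f z) = treeProj g (φ z) := rfl

theorem IsConjugacy.continuous_mapTree (hφ : IsConjugacy f g φ) (hf : 2 ≤ f.natDegree)
    (hg : 2 ≤ g.natDegree) : Continuous (hφ.mapTree hf hg) :=
  ((continuous_treeProj g).comp φ.continuous).quotient_lift fun _ _ h =>
    Quotient.sound (hφ.treeSetoid_map hf hg h)

/-- The homeomorphism of trees induced by a conjugacy. -/
noncomputable def IsConjugacy.treeHomeomorph (hφ : IsConjugacy f g φ) (hf : 2 ≤ f.natDegree)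
    (hg : 2 ≤ g.natDegree) : Tree f ≃ₜ Tree g where
  toFun := hφ.mapTree hf hg
  invFun := hφ.symm.mapTree hg hf
  left_inv x := by
    obtain ⟨z, rfl⟩ := treeProj_surjective f x
    rw [mapTree_treeProj, mapTree_treeProj, φ.symm_apply_apply]
  right_inv x := by
    obtain ⟨z, rfl⟩ := treeProj_surjective g x
    rw [mapTree_treeProj, mapTree_treeProj, φ.apply_symm_apply]
  continuous_toFun := hφ.continuous_mapTree hf hg
  continuous_invFun := hφ.symm.continuous_mapTree hg hf

theorem IsConjugacy.treeHomeomorph_treeProj (hφ : IsConjugacy f g φ) (hf : 2 ≤ f.natDegree)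
    (hg : 2 ≤ g.natDegree) (z : basin f) :
    hφ.treeHomeomorph hf hg (treeProj f z) = treeProj g (φ z) := rfl

theorem treeMap_treeProj (f : Polynomial ℂ) (hf : 2 ≤ f.natDegree) (z : basin f) :
    treeMap f hf (treeProj f z) = treeProj f (basinMap f z) := rfl

theorem eVariationOn_le_mul_of_edist_le {α E E' : Type*} [LinearOrder α] [PseudoEMetricSpace E]
    [PseudoEMetricSpace E'] {u : α → E} {v : α → E'} {s : Set α} {C : ℝ≥0∞}
    (h : ∀ x y, edist (u x) (u y) ≤ C * edist (v x) (v y)) :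
    eVariationOn u s ≤ C * eVariationOn v s := by
  refine iSup_le fun p => ?_
  calc _ ≤ ∑ i ∈ Finset.range p.1, C * edist (v (p.2.1 (i + 1))) (v (p.2.1 i)) :=
        Finset.sum_le_sum fun i _ => h _ _
    _ = C * ∑ i ∈ Finset.range p.1, edist (v (p.2.1 (i + 1))) (v (p.2.1 i)) :=
        (Finset.mul_sum ..).symm
    _ ≤ _ := by
        gcongr
        exact le_iSup (fun p : ℕ × { u : ℕ → α // Monotone u ∧ ∀ i, u i ∈ s } =>
          ∑ i ∈ Finset.range p.1, edist (v (p.2.1 (i + 1))) (v (p.2.1 i))) p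

/-- A continuous map of trees that is `K`-Lipschitz in the heights is `K`-Lipschitz. -/
theorem treeDist_map_le {ι : Tree f → Tree g} (hι : Continuous ι) {K : ℝ} (hK : 0 < K)
    (h : ∀ x y, |treeHeight g (ι x) - treeHeight g (ι y)| ≤
      K * |treeHeight f x - treeHeight f y|) (x y : Tree f) :
    treeDist g (ι x) (ι y) ≤ ENNReal.ofReal K * treeDist f x y := by
  rw [treeDist, treeDist, ENNReal.mul_iInf_of_ne (ENNReal.ofReal_pos.2 hK).ne'
    ENNReal.ofReal_ne_top]
  -- Each path is compared with its image under ι, whose height variation is at most K times as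
  -- large.
  refine le_iInf fun γ => iInf_le_of_le (γ.map hι) ?_
  refine eVariationOn_le_mul_of_edist_le fun s t => ?_
  rw [edist_dist, edist_dist, ← ENNReal.ofReal_mul hK.le]
  exact ENNReal.ofReal_le_ofReal (h _ _)

theorem IsConjugacy.abs_green_sub_le (hφ : IsConjugacy f g φ) (hf : 2 ≤ f.natDegree)
    (hg : 2 ≤ g.natDegree) {K : ℝ} (hqc : IsQuasiconformal φ K) (z w : basin f) :
    |green f z - green f w| ≤ K * |green g (φ z) - green g (φ w)| ∧
      |green g (φ z) - green g (φ w)| ≤ K * |green f z - green f w| := by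
  wlog hzw : green f z ≤ green f w generalizing z w
  · rw [abs_sub_comm (green f z), abs_sub_comm (green g (φ z))]
    exact this w z (le_of_not_ge hzw)
  have h1 : green g (φ z) ≤ green g (φ w) :=
    not_lt.1 ((hφ.green_lt_iff hf hg w z).not.1 (not_lt.2 hzw))
  rw [abs_sub_comm (green f z), abs_sub_comm (green g (φ z)), abs_of_nonneg (sub_nonneg.2 hzw),
    abs_of_nonneg (sub_nonneg.2 h1)]
  exact hφ.green_sub_le hf hg hqc hzw

end Tree

end PolyBasin

theorem mainTheorem3 (f g : Polynomial ℂ) (hf : 2 ≤ f.natDegree) (hg : 2 ≤ g.natDegree)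
    (φ : PolyBasin.basin f ≃ₜ PolyBasin.basin g) (hφ : PolyBasin.IsConjugacy f g φ) :
    (∀ z₁ z₂ : PolyBasin.basin f,
      PolyBasin.green f z₁ > PolyBasin.green f z₂ ↔
        PolyBasin.green g (φ z₁) > PolyBasin.green g (φ z₂)) ∧
    (∀ K : ℝ, PolyBasin.IsQuasiconformal φ K → ∀ z₁ z₂ : PolyBasin.basin f,
      PolyBasin.green f z₁ ≥ PolyBasin.green f z₂ →
        (PolyBasin.green f z₁ - PolyBasin.green f z₂) / K
            ≤ PolyBasin.green g (φ z₁) - PolyBasin.green g (φ z₂) ∧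
        PolyBasin.green g (φ z₁) - PolyBasin.green g (φ z₂)
            ≤ K * (PolyBasin.green f z₁ - PolyBasin.green f z₂)) ∧
    (∃ ι : PolyBasin.Tree f ≃ₜ PolyBasin.Tree g,
      (∀ z : PolyBasin.basin f, ι (PolyBasin.treeProj f z) = PolyBasin.treeProj g (φ z)) ∧
      (∀ x : PolyBasin.Tree f,
        ι (PolyBasin.treeMap f hf x) = PolyBasin.treeMap g hg (ι x)) ∧
      (∀ x y : PolyBasin.Tree f,
        PolyBasin.treeHeight f x > PolyBasin.treeHeight f y ↔
          PolyBasin.treeHeight g (ι x) > PolyBasin.treeHeight g (ι y)) ∧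
      (∀ K : ℝ, PolyBasin.IsQuasiconformal φ K → ∀ x y : PolyBasin.Tree f,
        PolyBasin.treeDist f x y / ENNReal.ofReal K ≤ PolyBasin.treeDist g (ι x) (ι y) ∧
        PolyBasin.treeDist g (ι x) (ι y) ≤ ENNReal.ofReal K * PolyBasin.treeDist f x y)) := by
  refine ⟨fun z₁ z₂ => hφ.green_lt_iff hf hg z₂ z₁, fun K hK z₁ z₂ h => ?_,
    hφ.treeHomeomorph hf hg, hφ.treeHomeomorph_treeProj hf hg, fun x => ?_, fun x y => ?_,
    fun K hK x y => ?_⟩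
  · obtain ⟨h1, h2⟩ := hφ.green_sub_le hf hg hK h
    have hK0 : 0 < K := by linarith [hK.1]
    exact ⟨by rwa [div_le_iff₀' hK0], h2⟩
  · obtain ⟨z, rfl⟩ := PolyBasin.treeProj_surjective f x
    rw [PolyBasin.treeMap_treeProj, hφ.treeHomeomorph_treeProj, hφ.treeHomeomorph_treeProj,
      PolyBasin.treeMap_treeProj, hφ z]
  · obtain ⟨z, rfl⟩ := PolyBasin.treeProj_surjective f x
    obtain ⟨w, rfl⟩ := PolyBasin.treeProj_surjective f y
    exact hφ.green_lt_iff hf hg w z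
  · have hK0 : 0 < K := by linarith [hK.1]
    constructor
    -- The lower bound is the upper bound for the inverse homeomorphism, from the other half of the
    -- estimate on potentials.
    · refine ENNReal.div_le_of_le_mul' ?_
      have := PolyBasin.treeDist_map_le (hφ.treeHomeomorph hf hg).symm.continuous hK0
        (fun x' y' => ?_) (hφ.treeHomeomorph hf hg x) (hφ.treeHomeomorph hf hg y)
      · rwa [Homeomorph.symm_apply_apply, Homeomorph.symm_apply_apply] at this
      · obtain ⟨x, rfl⟩ := (hφ.treeHomeomorph hf hg).surjective x'
        obtain ⟨y, rfl⟩ := (hφ.treeHomeomorph hf hg).surjective y'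
        rw [Homeomorph.symm_apply_apply, Homeomorph.symm_apply_apply]
        obtain ⟨z, rfl⟩ := PolyBasin.treeProj_surjective f x
        obtain ⟨w, rfl⟩ := PolyBasin.treeProj_surjective f y
        exact (hφ.abs_green_sub_le hf hg hK z w).1
    · refine PolyBasin.treeDist_map_le (hφ.treeHomeomorph hf hg).continuous hK0
        (fun x y => ?_) x y
      obtain ⟨z, rfl⟩ := PolyBasin.treeProj_surjective f x
      obtain ⟨w, rfl⟩ := PolyBasin.treeProj_surjective f y
      exact (hφ.abs_green_sub_le hf hg hK z w).2
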